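/- Let $H$ be an infinite-dimensional (real or complex) Hilbert space. Then there are three closed subspaces $X_1,X_2,X_3$ of $H$ with the following property: for every $w_0\in H$ with $w_0\neq 0$ there is a sequence of indices $k_1,k_2,\dots\in\{1,2,3\}$ such that the sequence $(w_n)_{n\ge 0}$ defined by $w_n=P_{X_{k_n}}w_{n-1}$ for $n\ge 1$ does not converge in the norm of $H$. Here $P_X$ denotes the orthogonal projection of $H$ onto the closed subspace $X$. -/

import Mathlib

open Filter Topology

/-! ### Alternating projections and perturbation of projections -/

section Projections

variable {𝕜 : Type*} [RCLike 𝕜] {V : Type*} [NormedAddCommGroup V] [InnerProductSpace 𝕜 V]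

/-! The mechanism is a bounded sequence `v t` that does not converge, such that `v (t + 1)` is, up
to summable errors, a product of the three projections applied to `v t`. Projections are
contractions, so an orbit coming close enough to some `a • v 0` with `a ≠ 0` can be made to follow
`a • v t`, and diverges.

The vector `v t` rotates from one basis vector to the next by angles of order 1/t. Projecting it
onto the line of `v (t + 1)` costs a factor 1 - O(1/t²), so its length stays bounded below
(`half_le_rotLength`). Small private components make the rotating vectors independent. Inside their
span `E`, killing private coordinates isolates a line as far as `v t` can see. The coordinates are
listed in two orders so that two initial segments suffice for this (`eq_of_zigzag_le`,
`projOp_rotVec`).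

A whole decreasing chain of subspaces of `E` is stored in one closed subspace `Y`, the graph of a
sum of rank-one operators with rapidly decreasing coefficients: a suitable power of the compression
to `E` of the projection onto `Y` sees just the first m equations (`exists_compression_pow_near`).
Two orders require two subspaces `Y`, `Y'`. Together with `E` these are the three subspaces, and von
Neumann's theorem yields the intersections of chain members (`exists_projWords_near`).

Moreover `E ⊓ Y'` is the line of `v 0`, so every vector not orthogonal to all words applied to `v 0`
has a divergent orbit (`hasDivergentOrbit_of_wandering`). Hence all nonzero vectors of the cyclic
subspace of `v 0` do. That subspace is separable, and `H` is an orthogonal sum of copies of it. -/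

/-- Powers of a symmetric operator `A` with `A ^ 2 ≤ A` converge strongly to the orthogonal
projection onto the fixed space of `A`. -/
theorem exists_tendsto_pow_of_isSymmetric [CompleteSpace V] {A : V →L[𝕜] V}
    (hs : ∀ x y, inner 𝕜 (A x) y = inner 𝕜 x (A y))
    (hA : ∀ x, ‖A x‖ ^ 2 ≤ RCLike.re (inner 𝕜 (A x) x)) (x : V) :
    ∃ y, Tendsto (fun n => (A ^ n) x) atTop (𝓝 y) ∧ A y = y ∧
      ∀ z, A z = z → inner 𝕜 y z = inner 𝕜 x z := by
  have hn : ∀ x, ‖A x‖ ≤ ‖x‖ := fun x => by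
    have h1 := (hA x).trans ((RCLike.re_le_norm _).trans (norm_inner_le_norm (A x) x))
    by_contra! h
    nlinarith [norm_nonneg x]
  have hsucc : ∀ n y, (A ^ (n + 1)) y = A ((A ^ n) y) := fun n y => by
    rw [pow_succ']; rfl
  have hij : ∀ i j, inner 𝕜 ((A ^ i) x) ((A ^ j) x) = inner 𝕜 ((A ^ (i + j)) x) x := by
    intro i j
    induction j generalizing i with
    | zero => simp
    | succ j ih =>
      rw [hsucc, ← hs, ← hsucc, ih]
      congr 3; ring
  -- Even terms are ‖A^j x‖², odd terms ⟨A A^j x, A^j x⟩. Contractivity and `A ^ 2 ≤ A` make `a`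
  -- decreasing, and squared distances in the orbit are a(2n) + a(2m) - 2a(n+m), which tends to 0.
  set a : ℕ → ℝ := fun k => RCLike.re (inner 𝕜 ((A ^ k) x) x) with ha
  have hsq : ∀ j, a (j + j) = ‖(A ^ j) x‖ ^ 2 := fun j => by
    simp only [ha]; rw [← hij, inner_self_eq_norm_sq]
  have hodd : ∀ j, a (j + 1 + j) = RCLike.re (inner 𝕜 (A ((A ^ j) x)) ((A ^ j) x)) := fun j => by
    simp only [ha]; rw [← hij, hsucc]
  have hanti : Antitone a := by
    refine antitone_nat_of_succ_le fun k => ?_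
    rcases Nat.even_or_odd' k with ⟨j, rfl | rfl⟩
    · rw [show 2 * j + 1 = j + 1 + j by ring, show 2 * j = j + j by ring, hodd, hsq]
      have := (RCLike.re_le_norm _).trans (norm_inner_le_norm (𝕜 := 𝕜) (A ((A ^ j) x)) ((A ^ j) x))
      nlinarith [hn ((A ^ j) x), norm_nonneg ((A ^ j) x)]
    · rw [show 2 * j + 1 + 1 = (j + 1) + (j + 1) by ring, show 2 * j + 1 = j + 1 + j by ring,
        hodd, hsq, hsucc]
      exact hA _
  have hpos : ∀ k, 0 ≤ a k := fun k => by
    have h1 := hanti (show k ≤ k + k by omega)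
    rw [hsq] at h1
    exact (sq_nonneg _).trans h1
  obtain ⟨l, hl⟩ : ∃ l, Tendsto a atTop (𝓝 l) :=
    ⟨_, tendsto_atTop_ciInf hanti ⟨0, by rintro _ ⟨k, rfl⟩; exact hpos k⟩⟩
  have hle : ∀ k, l ≤ a k := fun k => hanti.le_of_tendsto hl k
  have hdist : ∀ n m, ‖(A ^ n) x - (A ^ m) x‖ ^ 2 = a (n + n) + a (m + m) - 2 * a (n + m) := by
    intro n m
    rw [@norm_sub_sq 𝕜, hsq, hsq, hij]
    simp only [ha]; ring
  have hC : CauchySeq fun n => (A ^ n) x := by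
    rw [Metric.cauchySeq_iff]
    intro ε hε
    obtain ⟨N, hN⟩ := eventually_atTop.1
      (hl.eventually (gt_mem_nhds (show l < l + ε ^ 2 / 2 by have := pow_pos hε 2; linarith)))
    refine ⟨N, fun m hm n hn => ?_⟩
    rw [dist_eq_norm]
    refine lt_of_pow_lt_pow_left₀ 2 hε.le ?_
    rw [hdist]
    have h1 := hN (m + m) (by omega)
    have h2 := hN (n + n) (by omega)
    have h3 := hle (m + n)
    linarith
  obtain ⟨y, hy⟩ := cauchySeq_tendsto_of_complete hC
  refine ⟨y, hy, ?_, fun z hz => ?_⟩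
  · have h1 : Tendsto (fun n => (A ^ (n + 1)) x) atTop (𝓝 (A y)) := by
      simp only [hsucc]
      exact (A.continuous.tendsto y).comp hy
    exact tendsto_nhds_unique h1 (hy.comp (tendsto_add_atTop_nat 1))
  · have h1 : ∀ n, inner 𝕜 ((A ^ n) x) z = inner 𝕜 x z := by
      intro n
      induction n with
      | zero => simp
      | succ n ih => rw [hsucc, hs, hz, ih]
    have h2 : Tendsto (fun n => inner 𝕜 ((A ^ n) x) z) atTop (𝓝 (inner 𝕜 y z)) :=
      hy.inner tendsto_const_nhds
    simp only [h1] at h2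
    exact (tendsto_nhds_unique h2 tendsto_const_nhds)

theorem norm_pow_le_one {A : V →L[𝕜] V} (hA : ‖A‖ ≤ 1) (n : ℕ) : ‖A ^ n‖ ≤ 1 := by
  rcases Nat.eq_zero_or_pos n with rfl | h
  · exact (pow_zero A).symm ▸ ContinuousLinearMap.norm_id_le
  · exact (norm_pow_le' A h).trans (pow_le_one₀ (norm_nonneg _) hA)

/-- Powers of contractions depend on the contraction in a Lipschitz way. -/
theorem norm_pow_sub_pow_le {A B : V →L[𝕜] V} (hA : ‖A‖ ≤ 1) (hB : ‖B‖ ≤ 1) (n : ℕ) :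
    ‖A ^ n - B ^ n‖ ≤ n * ‖A - B‖ := by
  induction n with
  | zero => simp
  | succ n ih =>
    have hBn : ‖B ^ n‖ ≤ 1 := norm_pow_le_one hB n
    have h1 : A ^ (n + 1) - B ^ (n + 1) = (A ^ n - B ^ n) * A + B ^ n * (A - B) := by
      rw [pow_succ, pow_succ]; noncomm_ring
    rw [h1]
    calc _ ≤ ‖A ^ n - B ^ n‖ * ‖A‖ + ‖B ^ n‖ * ‖A - B‖ :=
          (norm_add_le _ _).trans (add_le_add (norm_mul_le _ _) (norm_mul_le _ _))
      _ ≤ (n * ‖A - B‖) * 1 + 1 * ‖A - B‖ := by gcongr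
      _ = _ := by push_cast; ring

variable [CompleteSpace V]

/-- The orthogonal projection onto a closed subspace. -/
noncomputable abbrev projOp (X : ClosedSubmodule 𝕜 V) : V →L[𝕜] V := X.toSubmodule.starProjection

theorem projOp_mem (X : ClosedSubmodule 𝕜 V) (x : V) : projOp X x ∈ X :=
  X.toSubmodule.starProjection_apply_mem x

theorem projOp_eq_self {X : ClosedSubmodule 𝕜 V} {x : V} (hx : x ∈ X) : projOp X x = x :=
  Submodule.starProjection_eq_self_iff.2 hx

theorem norm_projOp_le (X : ClosedSubmodule 𝕜 V) : ‖projOp X‖ ≤ 1 :=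
  X.toSubmodule.starProjection_norm_le

theorem norm_projOp_apply_le (X : ClosedSubmodule 𝕜 V) (x : V) : ‖projOp X x‖ ≤ ‖x‖ :=
  X.toSubmodule.norm_starProjection_apply_le x

theorem projOp_symm (X : ClosedSubmodule 𝕜 V) (x y : V) :
    inner 𝕜 (projOp X x) y = inner 𝕜 x (projOp X y) :=
  Submodule.inner_starProjection_left_eq_right _ x y

theorem projOp_idem (X : ClosedSubmodule 𝕜 V) (x : V) : projOp X (projOp X x) = projOp X x :=
  projOp_eq_self (projOp_mem X x)

theorem projOp_eq {X : ClosedSubmodule 𝕜 V} {x y : V} (hy : y ∈ X)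
    (h : ∀ z ∈ X, inner 𝕜 (x - y) z = 0) : projOp X x = y :=
  Submodule.eq_starProjection_of_mem_of_inner_eq_zero hy h

/-- The compression `P_U P_W P_U`. -/
noncomputable def compression (U W : ClosedSubmodule 𝕜 V) : V →L[𝕜] V :=
  projOp U * projOp W * projOp U

theorem compression_apply (U W : ClosedSubmodule 𝕜 V) (x : V) :
    compression U W x = projOp U (projOp W (projOp U x)) := rfl

theorem norm_compression_le (U W : ClosedSubmodule 𝕜 V) : ‖compression U W‖ ≤ 1 := by
  refine ContinuousLinearMap.opNorm_le_bound _ zero_le_one fun x => ?_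
  rw [compression_apply, one_mul]
  exact (norm_projOp_apply_le _ _).trans
    ((norm_projOp_apply_le _ _).trans (norm_projOp_apply_le _ _))

theorem compression_eq_self_iff {U W : ClosedSubmodule 𝕜 V} {x : V} :
    compression U W x = x ↔ x ∈ U ⊓ W := by
  constructor
  · intro h
    rw [compression_apply] at h
    have h1 : ‖x‖ ≤ ‖projOp W (projOp U x)‖ := by
      conv_lhs => rw [← h]
      exact norm_projOp_apply_le _ _
    have hU : x ∈ U := by rw [← h]; exact projOp_mem _ _
    have h2 : projOp U x = x := projOp_eq_self hU
    rw [h2] at h1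
    refine ⟨hU, ?_⟩
    exact (Submodule.mem_iff_norm_starProjection W.toSubmodule x).2
      (le_antisymm (norm_projOp_apply_le W x) h1)
  · rintro ⟨hU, hW⟩
    rw [compression_apply, projOp_eq_self hU, projOp_eq_self hW, projOp_eq_self hU]

/-- Von Neumann's theorem on alternating projections. -/
theorem tendsto_compression_pow (U W : ClosedSubmodule 𝕜 V) (x : V) :
    Tendsto (fun n => (compression U W ^ n) x) atTop (𝓝 (projOp (U ⊓ W) x)) := by
  obtain ⟨y, hy, hAy, hz⟩ := exists_tendsto_pow_of_isSymmetric (A := compression U W)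
    (fun x y => by simp only [compression_apply, projOp_symm])
    (fun x => by
      rw [compression_apply, projOp_symm, ← projOp_idem W, projOp_symm, inner_self_eq_norm_sq]
      gcongr
      rw [projOp_idem]
      exact norm_projOp_apply_le _ _) x
  rwa [projOp_eq (x := x) (compression_eq_self_iff.1 hAy) fun z hzm => by
    rw [inner_sub_left, hz z (compression_eq_self_iff.2 hzm), sub_self]]

/-- Alternating projections converge in operator norm if the relevant part of `U` is
finite-dimensional. -/
theorem tendsto_compression_pow_norm (U W : ClosedSubmodule 𝕜 V)
    [FiniteDimensional 𝕜 ↥(U.toSubmodule ⊓ (U ⊓ W).toSubmoduleᗮ)] :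
    Tendsto (fun n => compression U W ^ n) atTop (𝓝 (projOp (U ⊓ W))) := by
  set D := U.toSubmodule ⊓ (U ⊓ W).toSubmoduleᗮ with hD
  set q := stdOrthonormalBasis 𝕜 D with hq
  have hlim : Tendsto (fun n => ∑ i, ‖(compression U W ^ n) (q i) - projOp (U ⊓ W) (q i)‖) atTop
      (𝓝 0) := by
    rw [show (0 : ℝ) = ∑ i : Fin (Module.finrank 𝕜 D), 0 by simp]
    refine tendsto_finsetSum _ fun i _ => ?_
    exact tendsto_iff_norm_sub_tendsto_zero.1 (tendsto_compression_pow U W (q i))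
  rw [tendsto_iff_norm_sub_tendsto_zero]
  refine squeeze_zero' (Eventually.of_forall fun _ => norm_nonneg _) ?_ hlim
  -- For n ≥ 1, but not for n = 0, the difference vanishes on Uᗮ. It also vanishes on U ⊓ W, so only
  -- the component in `D` matters.
  filter_upwards [eventually_ge_atTop 1] with n hn
  refine ContinuousLinearMap.opNorm_le_bound _ (Finset.sum_nonneg fun _ _ => norm_nonneg _)
    fun x => ?_
  have hPU : ∀ z, projOp (U ⊓ W) (projOp U z) = projOp (U ⊓ W) z := fun z => by
    refine (projOp_eq (projOp_mem _ _) fun w hw => ?_).symm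
    have h1 : inner 𝕜 (z - projOp U z) w = 0 :=
      Submodule.starProjection_inner_eq_zero z w hw.1
    have h2 : inner 𝕜 (projOp U z - projOp (U ⊓ W) (projOp U z)) w = 0 :=
      Submodule.starProjection_inner_eq_zero (K := (U ⊓ W).toSubmodule) _ w hw
    rw [← sub_add_sub_cancel z (projOp U z), inner_add_left, h1, h2, add_zero]
  have hAU : ∀ z, (compression U W ^ n) (projOp U z) = (compression U W ^ n) z := fun z => by
    obtain ⟨k, rfl⟩ : ∃ k, n = k + 1 := ⟨n - 1, by omega⟩
    rw [pow_succ]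
    change (compression U W ^ k) (compression U W (projOp U z)) =
      (compression U W ^ k) (compression U W z)
    rw [compression_apply, projOp_idem, ← compression_apply]
  have hfix : ∀ z ∈ U ⊓ W, (compression U W ^ n) z = z := fun z hz => by
    clear hAU hn
    induction n with
    | zero => rfl
    | succ k ih =>
      rw [pow_succ]
      change (compression U W ^ k) (compression U W z) = z
      rw [compression_eq_self_iff.2 hz, ih]
  set d : V := projOp U x - projOp (U ⊓ W) (projOp U x) with hd
  have hdD : d ∈ D := ⟨sub_mem (projOp_mem U x) (projOp_mem (U ⊓ W) _).1,
    Submodule.sub_starProjection_mem_orthogonal _⟩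
  have hdn : ‖d‖ ≤ ‖x‖ := by
    have h1 : projOp U x - projOp (U ⊓ W) (projOp U x) =
        (U ⊓ W).toSubmoduleᗮ.starProjection (projOp U x) := by
      rw [Submodule.starProjection_orthogonal_val]
    rw [hd, h1]
    exact (Submodule.norm_starProjection_apply_le _ _).trans (norm_projOp_apply_le _ _)
  have hx : (compression U W ^ n - projOp (U ⊓ W)) x =
      (compression U W ^ n - projOp (U ⊓ W)) d := by
    simp only [sub_apply, hd, map_sub, hAU, projOp_idem, hPU,
      hfix _ (projOp_mem (U ⊓ W) x)]
    abel
  have hsum : d = ∑ i, inner 𝕜 (q i : V) d • (q i : V) := by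
    have := congrArg (Submodule.subtype D) (q.sum_repr' ⟨d, hdD⟩)
    simpa using this.symm
  rw [hx, hsum, map_sum, Finset.sum_mul]
  refine (norm_sum_le _ _).trans (Finset.sum_le_sum fun i _ => ?_)
  rw [map_smul, norm_smul, mul_comm, sub_apply]
  refine mul_le_mul_of_nonneg_left ?_ (norm_nonneg _)
  refine (norm_inner_le_norm _ _).trans ?_
  have : ‖(q i : V)‖ = 1 := q.orthonormal.1 i
  rw [this, one_mul]
  exact hdn

/-- Closed subspaces which are close to each other have close orthogonal projections. -/
theorem norm_projOp_sub_le {Y Z : ClosedSubmodule 𝕜 V} {δ : ℝ} (hδ : 0 ≤ δ)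
    (hYZ : ∀ y ∈ Y, ∃ z ∈ Z, ‖y - z‖ ≤ δ * ‖y‖) (hZY : ∀ z ∈ Z, ∃ y ∈ Y, ‖z - y‖ ≤ δ * ‖z‖) :
    ‖projOp Y - projOp Z‖ ≤ 2 * δ := by
  have key : ∀ {Y Z : ClosedSubmodule 𝕜 V}, (∀ y ∈ Y, ∃ z ∈ Z, ‖y - z‖ ≤ δ * ‖y‖) →
      ∀ x, ‖projOp Y x - projOp Z (projOp Y x)‖ ≤ δ * ‖x‖ := by
    intro Y Z h x
    obtain ⟨z, hz, hle⟩ := h _ (projOp_mem Y x)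
    have h1 : ‖projOp Y x - projOp Z (projOp Y x)‖ ≤ ‖projOp Y x - z‖ := by
      have h2 : projOp Y x - projOp Z (projOp Y x) =
          Z.toSubmoduleᗮ.starProjection (projOp Y x - z) := by
        rw [map_sub, Submodule.starProjection_orthogonal_val,
          Submodule.starProjection_orthogonal_val]
        change _ = _ - (z - projOp Z z)
        rw [projOp_eq_self hz, sub_self, sub_zero]
      rw [h2]
      exact Submodule.norm_starProjection_apply_le _ _
    exact h1.trans (hle.trans (by gcongr; exact norm_projOp_apply_le _ _))
  -- This operator is the adjoint of the one bounded by `key hYZ`.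
  have hadj : ∀ x, ‖projOp Y x - projOp Y (projOp Z x)‖ ≤ δ * ‖x‖ := by
    intro x
    set w := projOp Y x - projOp Y (projOp Z x) with hw
    have h1 : inner 𝕜 w w = inner 𝕜 x (projOp Y w - projOp Z (projOp Y w)) := by
      calc inner 𝕜 w w = inner 𝕜 (projOp Y (x - projOp Z x)) w := by rw [map_sub]
        _ = _ := by rw [projOp_symm, inner_sub_left, projOp_symm Z, inner_sub_right]
    have h2 : ‖w‖ ^ 2 ≤ ‖x‖ * (δ * ‖w‖) := by
      rw [← @inner_self_eq_norm_sq 𝕜, h1]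
      refine (RCLike.re_le_norm _).trans ((norm_inner_le_norm _ _).trans ?_)
      gcongr
      exact key hYZ w
    by_contra! h
    nlinarith [norm_nonneg w, mul_nonneg hδ (norm_nonneg x)]
  refine ContinuousLinearMap.opNorm_le_bound _ (by positivity) fun x => ?_
  have h1 : (projOp Y - projOp Z) x = (projOp Y x - projOp Y (projOp Z x)) -
      (projOp Z x - projOp Y (projOp Z x)) := by simp
  rw [h1]
  refine (norm_sub_le _ _).trans ?_
  linarith [hadj x, key hZY x]

end Projections

/-! ### Encoding a chain of subspaces in one graph -/

section Graphs

variable {𝕜 : Type*} [RCLike 𝕜] {V : Type*} [NormedAddCommGroup V] [InnerProductSpace 𝕜 V]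
  [CompleteSpace V]

/-- The graph `{x + T x | x ∈ E}` of an operator `T` from `E` into the orthogonal complement
of `E`. -/
noncomputable def graphOver (E : ClosedSubmodule 𝕜 V) (T : V →L[𝕜] V) : ClosedSubmodule 𝕜 V where
  toSubmodule := (ContinuousLinearMap.id 𝕜 V - projOp E - T ∘L projOp E).ker
  isClosed' := ContinuousLinearMap.isClosed_ker _

variable {E : ClosedSubmodule 𝕜 V} {T S : V →L[𝕜] V}

theorem mem_graphOver {y : V} : y ∈ graphOver E T ↔ y = projOp E y + T (projOp E y) := by
  change y ∈ (ContinuousLinearMap.id 𝕜 V - projOp E - T ∘L projOp E).ker ↔ _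
  rw [LinearMap.mem_ker]
  change y - projOp E y - T (projOp E y) = 0 ↔ _
  rw [sub_sub, sub_eq_zero]

theorem add_mem_graphOver (hT : ∀ x, projOp E (T x) = 0) {x : V} (hx : x ∈ E) :
    x + T x ∈ graphOver E T := by
  rw [mem_graphOver, map_add, hT, projOp_eq_self hx, add_zero]

theorem mem_inf_graphOver {x : V} : x ∈ E ⊓ graphOver E T ↔ x ∈ E ∧ T x = 0 := by
  constructor
  · rintro ⟨hE, hG⟩
    have hG := mem_graphOver.1 hG
    rw [projOp_eq_self hE] at hG
    exact ⟨hE, by simpa using hG⟩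
  · rintro ⟨hE, h⟩
    refine ⟨hE, ?_⟩
    exact mem_graphOver.2 (by rw [projOp_eq_self hE, h, add_zero])

/-- Passing from x + T x to x + S x moves the point by (T - S) x, and x, being the projection of x +
T x onto `E`, is no longer than x + T x. -/
theorem norm_projOp_graphOver_sub_le (hT : ∀ x, projOp E (T x) = 0)
    (hS : ∀ x, projOp E (S x) = 0) :
    ‖projOp (graphOver E T) - projOp (graphOver E S)‖ ≤ 2 * ‖T - S‖ := by
  have key : ∀ {T S : V →L[𝕜] V}, (∀ x, projOp E (S x) = 0) → ∀ y ∈ graphOver E T,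
      ∃ z ∈ graphOver E S, ‖y - z‖ ≤ ‖T - S‖ * ‖y‖ := by
    intro T S hS y hy
    refine ⟨_, add_mem_graphOver hS (projOp_mem E y), ?_⟩
    have h1 : y - (projOp E y + S (projOp E y)) = (T - S) (projOp E y) := by
      have h2 : T (projOp E y) = y - projOp E y := eq_sub_of_add_eq' (mem_graphOver.1 hy).symm
      rw [sub_apply, h2, sub_sub]
    rw [h1]
    exact ((T - S).le_opNorm _).trans (by gcongr; exact norm_projOp_apply_le _ _)
  refine norm_projOp_sub_le (norm_nonneg _) (key hS) fun z hz => ?_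
  rw [norm_sub_rev T S]
  exact key hT z hz

theorem norm_compression_sub_le (E Y Z : ClosedSubmodule 𝕜 V) :
    ‖compression E Y - compression E Z‖ ≤ ‖projOp Y - projOp Z‖ := by
  have h : compression E Y - compression E Z = projOp E * (projOp Y - projOp Z) * projOp E := by
    simp only [compression]; noncomm_ring
  rw [h]
  calc _ ≤ ‖projOp E‖ * ‖projOp Y - projOp Z‖ * ‖projOp E‖ :=
        (norm_mul_le _ _).trans (by gcongr; exact norm_mul_le _ _)
    _ ≤ 1 * ‖projOp Y - projOp Z‖ * 1 := by gcongr <;> exact norm_projOp_le _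
    _ = _ := by ring

/-- A suitable power of the compression of the graph of a finite-rank operator is close to the
projection onto its kernel, stably under small perturbations of the operator. -/
theorem exists_pow_compression_graphOver_stable
    [FiniteDimensional 𝕜 ↥(E.toSubmodule ⊓ (E ⊓ graphOver E T).toSubmoduleᗮ)]
    (hT : ∀ x, projOp E (T x) = 0) {ε : ℝ} (hε : 0 < ε) :
    ∃ κ > 0, ∃ s : ℕ, ∀ S : V →L[𝕜] V, (∀ x, projOp E (S x) = 0) → ‖T - S‖ ≤ κ →
      ‖compression E (graphOver E S) ^ s - projOp (E ⊓ graphOver E T)‖ ≤ ε := by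
  obtain ⟨s, hs⟩ := ((tendsto_iff_norm_sub_tendsto_zero.1
    (tendsto_compression_pow_norm E (graphOver E T))).eventually
      (gt_mem_nhds (show (0 : ℝ) < ε / 2 by positivity))).exists
  -- A perturbation κ moves the graph projection by at most 2κ and the s-th power by at most 2sκ ≤ ε
  -- / 2; s + 1 covers s = 0.
  refine ⟨ε / (4 * (s + 1)), by positivity, s, fun S hS hST => ?_⟩
  have h1 : ‖compression E (graphOver E S) ^ s - compression E (graphOver E T) ^ s‖ ≤ ε / 2 := by
    calc _ ≤ s * ‖compression E (graphOver E S) - compression E (graphOver E T)‖ :=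
          norm_pow_sub_pow_le (norm_compression_le _ _) (norm_compression_le _ _) s
      _ ≤ s * (2 * (ε / (4 * (s + 1)))) := by
          gcongr
          refine (norm_compression_sub_le _ _ _).trans
            ((norm_projOp_graphOver_sub_le hS hT).trans ?_)
          rw [norm_sub_rev]
          gcongr
      _ ≤ (s + 1) * (2 * (ε / (4 * (s + 1)))) := by gcongr; linarith
      _ = ε / 2 := by field_simp; norm_num
  calc _ ≤ _ := norm_sub_le_norm_sub_add_norm_sub _ (compression E (graphOver E T) ^ s) _
    _ ≤ ε := by linarith

/-- For every sequence of vectors `g` there is a closed subspace `Y` such that the projections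
onto all the subspaces `{x ∈ E | ∀ i < m, ⟪g i, x⟫ = 0}` are approximated as well as prescribed by
powers of `P_E P_Y P_E`. -/
theorem exists_compression_pow_near (E : ClosedSubmodule 𝕜 V) {f : ℕ → V} (hf : Orthonormal 𝕜 f)
    (hfE : ∀ n, projOp E (f n) = 0) (g : ℕ → V) {ε : ℕ → ℝ} (hε : ∀ m, 0 < ε m) :
    ∃ Y : ClosedSubmodule 𝕜 V, (∀ x, x ∈ E ⊓ Y ↔ x ∈ E ∧ ∀ i, inner 𝕜 (g i) x = 0) ∧
      ∀ (m : ℕ) (L : ClosedSubmodule 𝕜 V), (∀ x, x ∈ L ↔ x ∈ E ∧ ∀ i < m, inner 𝕜 (g i) x = 0) →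
        ∃ s : ℕ, ‖compression E Y ^ s - projOp L‖ ≤ ε m := by
  classical
  -- The tolerance is made total in `T`, with junk value 1, because the recursion below uses it
  -- before its operators are known to satisfy the hypotheses.
  have hK : ∀ (m : ℕ) (T : V →L[𝕜] V), ∃ κ > 0,
      FiniteDimensional 𝕜 ↥(E.toSubmodule ⊓ (E ⊓ graphOver E T).toSubmoduleᗮ) →
      (∀ x, projOp E (T x) = 0) → ∃ s : ℕ, ∀ S : V →L[𝕜] V, (∀ x, projOp E (S x) = 0) →
      ‖T - S‖ ≤ κ → ‖compression E (graphOver E S) ^ s - projOp (E ⊓ graphOver E T)‖ ≤ ε m := by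
    intro m T
    by_cases h : FiniteDimensional 𝕜 ↥(E.toSubmodule ⊓ (E ⊓ graphOver E T).toSubmoduleᗮ) ∧
      ∀ x, projOp E (T x) = 0
    · have := h.1
      obtain ⟨κ, hκ, s, hs⟩ := exists_pow_compression_graphOver_stable h.2 (hε m)
      exact ⟨κ, hκ, fun _ _ => ⟨s, hs⟩⟩
    · exact ⟨1, one_pos, fun h1 h2 => (h ⟨h1, h2⟩).elim⟩
  choose K hKpos hK using hK
  let R : ℕ → V →L[𝕜] V := fun m => (innerSL 𝕜 (g m)).smulRight (f m)
  have hR : ∀ m x, R m x = inner 𝕜 (g m) x • f m := fun m x => rfl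
  -- The new rank-one term has norm at most half the current tolerance, and tolerances at least
  -- halve. So the limit `B` stays within `κ m` of every `A m`.
  let nxt : ℕ → (V →L[𝕜] V) × ℝ → V →L[𝕜] V := fun m p =>
    p.1 + ((p.2 / (2 * (‖g m‖ + 1)) : ℝ) : 𝕜) • R m
  let st : ℕ → (V →L[𝕜] V) × ℝ := fun m => Nat.rec (0, K 0 0)
    (fun m p => (nxt m p, min (p.2 / 2) (K (m + 1) (nxt m p)))) m
  let A : ℕ → V →L[𝕜] V := fun m => (st m).1
  let κ : ℕ → ℝ := fun m => (st m).2
  let c : ℕ → ℝ := fun m => κ m / (2 * (‖g m‖ + 1))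
  have hA0 : A 0 = 0 := rfl
  have hAs : ∀ m, A (m + 1) = A m + (c m : 𝕜) • R m := fun m => rfl
  have hκs : ∀ m, κ (m + 1) = min (κ m / 2) (K (m + 1) (A (m + 1))) := fun m => rfl
  have hκpos : ∀ m, 0 < κ m := by
    intro m
    induction m with
    | zero => exact hKpos _ _
    | succ m ih => rw [hκs]; exact lt_min (by linarith) (hKpos _ _)
  have hκK : ∀ m, κ m ≤ K m (A m) := by
    rintro (_ | m)
    · exact le_rfl
    · rw [hκs]; exact min_le_right _ _
  have hκgeo : ∀ m n, κ (m + n) ≤ κ m / 2 ^ n := by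
    intro m n
    induction n with
    | zero => simp
    | succ n ih =>
      rw [← add_assoc, hκs, pow_succ]
      refine (min_le_left _ _).trans ?_
      rw [← div_div]
      linarith
  have hcpos : ∀ m, 0 < c m := fun m => div_pos (hκpos m) (by positivity)
  have hAsum : ∀ m x, A m x = ∑ i ∈ Finset.range m, ((c i : 𝕜) * inner 𝕜 (g i) x) • f i := by
    intro m x
    induction m with
    | zero => simp [hA0]
    | succ m ih =>
      rw [hAs, Finset.sum_range_succ, ← ih, add_apply, mul_smul]
      rfl
  have hEA : ∀ m x, projOp E (A m x) = 0 := fun m x => by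
    rw [hAsum, map_sum]
    exact Finset.sum_eq_zero fun i _ => by rw [map_smul, hfE, smul_zero]
  have hAcoord : ∀ m x, ∀ j < m, inner 𝕜 (f j) (A m x) = (c j : 𝕜) * inner 𝕜 (g j) x := by
    intro m x j hj
    rw [hAsum]
    exact hf.inner_right_sum (fun i => (c i : 𝕜) * inner 𝕜 (g i) x) (Finset.mem_range.2 hj)
  have hcne : ∀ j, (c j : 𝕜) ≠ 0 := fun j => by exact_mod_cast (hcpos j).ne'
  have hAker : ∀ m x, A m x = 0 ↔ ∀ i < m, inner 𝕜 (g i) x = 0 := by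
    intro m x
    constructor
    · intro h i hi
      have := hAcoord m x i hi
      rw [h, inner_zero_right] at this
      exact (mul_eq_zero.1 this.symm).resolve_left (hcne i)
    · intro h
      rw [hAsum]
      exact Finset.sum_eq_zero fun i hi => by rw [h i (Finset.mem_range.1 hi), mul_zero, zero_smul]
  have hfd : ∀ m, FiniteDimensional 𝕜
      ↥(E.toSubmodule ⊓ (E ⊓ graphOver E (A m)).toSubmoduleᗮ) := by
    intro m
    let φ : ↥(E.toSubmodule ⊓ (E ⊓ graphOver E (A m)).toSubmoduleᗮ) →ₗ[𝕜] (Fin m → 𝕜) :=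
      LinearMap.pi fun i => (innerSL 𝕜 (g i)).toLinearMap ∘ₗ Submodule.subtype _
    refine FiniteDimensional.of_injective φ ((injective_iff_map_eq_zero φ).2 ?_)
    rintro ⟨x, hxE, hxo⟩ h
    have hx : A m x = 0 := (hAker m x).2 fun i hi => congrFun h ⟨i, hi⟩
    have h2 : inner 𝕜 x x = 0 :=
      (Submodule.mem_orthogonal _ _).1 hxo x (mem_inf_graphOver.2 ⟨hxE, hx⟩)
    exact Subtype.ext (inner_self_eq_zero.1 h2)
  have hRn : ∀ m, ‖(c m : 𝕜) • R m‖ ≤ κ m / 2 := by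
    intro m
    rw [norm_smul, RCLike.norm_ofReal, abs_of_pos (hcpos m)]
    have h1 : ‖R m‖ ≤ ‖g m‖ := by
      refine ContinuousLinearMap.opNorm_le_bound _ (norm_nonneg _) fun x => ?_
      rw [hR, norm_smul, hf.1 m, mul_one]
      exact norm_inner_le_norm _ _
    calc c m * ‖R m‖ ≤ c m * (‖g m‖ + 1) := by
          have := (hcpos m).le
          gcongr; linarith
      _ = κ m / 2 := by
          have : ‖g m‖ + 1 ≠ 0 := by positivity
          simp only [c]; field_simp
  have hdist : ∀ m n, dist (A (m + n)) (A (m + (n + 1))) ≤ κ m / 2 / 2 ^ n := by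
    intro m n
    rw [← add_assoc, hAs, dist_self_add_right]
    refine (hRn _).trans ?_
    have := hκgeo m n
    rw [div_right_comm]
    linarith
  obtain ⟨B, hB⟩ := cauchySeq_tendsto_of_complete
    (cauchySeq_of_le_geometric_two (f := A) (C := κ 0) fun n => by simpa using hdist 0 n)
  have hAB : ∀ m, ‖A m - B‖ ≤ κ m := by
    intro m
    rw [← dist_eq_norm]
    have hB' : Tendsto (fun n => A (m + n)) atTop (𝓝 B) := by
      have := hB.comp (tendsto_add_atTop_nat m)
      simp only [Function.comp_def, add_comm _ m] at this
      exact this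
    exact dist_le_of_le_geometric_two_of_tendsto₀ (f := fun n => A (m + n)) (hdist m) hB'
  have happ : ∀ x, Tendsto (fun m => A m x) atTop (𝓝 (B x)) := fun x =>
    ((ContinuousLinearMap.apply 𝕜 V x).continuous.tendsto B).comp hB
  have hEB : ∀ x, projOp E (B x) = 0 := fun x => by
    have h1 := ((projOp E).continuous.tendsto _).comp (happ x)
    exact tendsto_nhds_unique h1 (by simp [Function.comp_def, hEA])
  have hBcoord : ∀ x j, inner 𝕜 (f j) (B x) = (c j : 𝕜) * inner 𝕜 (g j) x := by
    intro x j
    have h1 : Tendsto (fun m => inner 𝕜 (f j) (A m x)) atTop (𝓝 (inner 𝕜 (f j) (B x))) :=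
      tendsto_const_nhds.inner (happ x)
    refine tendsto_nhds_unique h1 (tendsto_const_nhds.congr' ?_)
    filter_upwards [eventually_gt_atTop j] with m hm using (hAcoord m x j hm).symm
  refine ⟨graphOver E B, fun x => ?_, fun m L hL => ?_⟩
  · rw [mem_inf_graphOver]
    refine and_congr_right fun _ => ⟨fun h i => ?_, fun h => ?_⟩
    · have := hBcoord x i
      rw [h, inner_zero_right] at this
      exact (mul_eq_zero.1 this.symm).resolve_left (hcne i)
    · refine tendsto_nhds_unique (happ x) (tendsto_const_nhds.congr fun m => ?_)
      exact ((hAker m x).2 fun i _ => h i).symm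
  · obtain ⟨s, hs⟩ := hK m (A m) (hfd m) (hEA m)
    have hLeq : L = E ⊓ graphOver E (A m) := by
      refine SetLike.ext fun x => ?_
      rw [hL, mem_inf_graphOver, hAker]
    exact ⟨s, hLeq ▸ hs B hEB ((hAB m).trans (hκK m))⟩

end Graphs

/-! ### Words approximating intersections from two chains -/

section Words

variable {𝕜 : Type*} [RCLike 𝕜] {V : Type*} [NormedAddCommGroup V] [InnerProductSpace 𝕜 V]
  [CompleteSpace V]

/-- The monoid of all finite products of the projections onto the subspaces `X i`. -/
def projWords {ι : Type*} (X : ι → ClosedSubmodule 𝕜 V) : Submonoid (V →L[𝕜] V) :=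
  Submonoid.closure (Set.range fun i => projOp (X i))

theorem projOp_mem_projWords {ι : Type*} (X : ι → ClosedSubmodule 𝕜 V) (i : ι) :
    projOp (X i) ∈ projWords X :=
  Submonoid.subset_closure ⟨i, rfl⟩

theorem compression_mem_projWords {ι : Type*} (X : ι → ClosedSubmodule 𝕜 V) (i j : ι) :
    compression (X i) (X j) ∈ projWords X :=
  mul_mem (mul_mem (projOp_mem_projWords X i) (projOp_mem_projWords X j))
    (projOp_mem_projWords X i)

/-- Two chains of subspaces, given by two enumerations `σ` and `τ`, are encoded in two closed
subspaces `Y` and `Y'`; words in `E`, `Y`, `Y'` then approximate the projections onto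
intersections of members of the chains. -/
theorem exists_projWords_near (E : ClosedSubmodule 𝕜 V) {f : ℕ → V} (hf : Orthonormal 𝕜 f)
    (hfE : ∀ n, projOp E (f n) = 0) (q q' : ℕ → V) {σ τ : ℕ → ℕ} (hσ : σ.Injective)
    (hτ : τ.Injective) (L L' : ℕ → ClosedSubmodule 𝕜 V)
    (hL : ∀ t x, x ∈ L t ↔ x ∈ E ∧ ∀ i, σ i < σ t → inner 𝕜 (q i) x = 0)
    (hL' : ∀ t x, x ∈ L' t ↔ x ∈ E ∧ ∀ i, τ i < τ t → inner 𝕜 (q' i) x = 0)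
    (v : ℕ → V) {δ : ℕ → ℝ} (hδ : ∀ t, 0 < δ t) :
    ∃ Y Y' : ClosedSubmodule 𝕜 V, (∀ x, x ∈ E ⊓ Y' ↔ x ∈ E ∧ ∀ i, inner 𝕜 (q' i) x = 0) ∧
      ∀ t, ∃ W ∈ projWords ![E, Y, Y'], ‖W (v t) - projOp (L t ⊓ L' t) (v t)‖ ≤ δ t := by
  have hr : ∀ t, ∃ r : ℕ,
      ‖(compression (L t) (L' t) ^ r) (v t) - projOp (L t ⊓ L' t) (v t)‖ < δ t / 2 := fun t =>
    ((tendsto_iff_norm_sub_tendsto_zero.1 (tendsto_compression_pow (L t) (L' t) (v t))).eventually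
      (gt_mem_nhds (half_pos (hδ t)))).exists
  choose r hr using hr
  -- Replacing both projections by words costs 3ε in the compression, 3rε in its r-th power and
  -- 3rε‖v‖ on the vector, which is at most δ / 2.
  let ε : ℕ → ℝ := fun t => δ t / (6 * (r t + 1) * (‖v t‖ + 1))
  have hε : ∀ t, 0 < ε t := fun t => div_pos (hδ t) (by positivity)
  have chain : ∀ (q : ℕ → V) {σ : ℕ → ℕ}, σ.Injective → ∀ L : ℕ → ClosedSubmodule 𝕜 V,
      (∀ t x, x ∈ L t ↔ x ∈ E ∧ ∀ i, σ i < σ t → inner 𝕜 (q i) x = 0) →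
      ∃ Y : ClosedSubmodule 𝕜 V, (∀ x, x ∈ E ⊓ Y ↔ x ∈ E ∧ ∀ i, inner 𝕜 (q i) x = 0) ∧
        ∀ t, ∃ s : ℕ, ‖compression E Y ^ s - projOp (L t)‖ ≤ ε t := by
    intro q σ hσ L hL
    -- Condition `q i` sits at position `σ i`; unused positions carry the zero vector, a void
    -- condition.
    have hcond : ∀ (P : ℕ → Prop) x,
        (∀ i, P i → inner 𝕜 (Function.extend σ q 0 i) x = 0) ↔
          ∀ i, P (σ i) → inner 𝕜 (q i) x = 0 := by
      intro P x
      constructor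
      · intro h i hi
        simpa [hσ.extend_apply] using h (σ i) hi
      · intro h i hi
        by_cases hex : ∃ a, σ a = i
        · obtain ⟨a, rfl⟩ := hex
          rw [hσ.extend_apply]
          exact h a hi
        · rw [Function.extend_apply' _ _ _ hex]
          simp
    obtain ⟨Y, hY, hYs⟩ := exists_compression_pow_near E hf hfE (Function.extend σ q 0)
      (ε := Function.extend σ ε 1) (fun m => by
        by_cases hex : ∃ a, σ a = m
        · obtain ⟨a, rfl⟩ := hex
          rw [hσ.extend_apply]
          exact hε a
        · rw [Function.extend_apply' _ _ _ hex]
          exact one_pos)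
    refine ⟨Y, fun x => ?_, fun t => ?_⟩
    · have := hcond (fun _ => True) x
      simp only [forall_const] at this
      rw [hY, this]
    · have := hYs (σ t) (L t) fun x => by rw [hL, hcond fun i => i < σ t]
      rwa [hσ.extend_apply] at this
  obtain ⟨Y, -, hYs⟩ := chain q hσ L hL
  obtain ⟨Y', hY', hYs'⟩ := chain q' hτ L' hL'
  refine ⟨Y, Y', hY', fun t => ?_⟩
  obtain ⟨s, hs⟩ := hYs t
  obtain ⟨s', hs'⟩ := hYs' t
  set A := compression E Y ^ s with hA
  set B := compression E Y' ^ s' with hB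
  have hA1 : ‖A‖ ≤ 1 := norm_pow_le_one (norm_compression_le _ _) _
  have hB1 : ‖B‖ ≤ 1 := norm_pow_le_one (norm_compression_le _ _) _
  refine ⟨(A * B * A) ^ r t, ?_, ?_⟩
  · have h1 : A ∈ projWords ![E, Y, Y'] :=
      pow_mem (compression_mem_projWords ![E, Y, Y'] 0 1) s
    have h2 : B ∈ projWords ![E, Y, Y'] :=
      pow_mem (compression_mem_projWords ![E, Y, Y'] 0 2) s'
    exact pow_mem (mul_mem (mul_mem h1 h2) h1) _
  · have hABA : ‖A * B * A‖ ≤ 1 := by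
      calc _ ≤ ‖A‖ * ‖B‖ * ‖A‖ := (norm_mul_le _ _).trans (by gcongr; exact norm_mul_le _ _)
        _ ≤ 1 * 1 * 1 := by gcongr
        _ = 1 := by norm_num
    have hd : ‖A * B * A - compression (L t) (L' t)‖ ≤ 3 * ε t := by
      set P := projOp (L t)
      set P' := projOp (L' t)
      have hP : ‖P‖ ≤ 1 := norm_projOp_le _
      have hP' : ‖P'‖ ≤ 1 := norm_projOp_le _
      have h1 : A * B * A - compression (L t) (L' t) =
          (A - P) * (B * A) + P * ((B - P') * A) + P * P' * (A - P) := by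
        simp only [compression]; noncomm_ring
      have hε0 := (hε t).le
      rw [h1]
      calc _ ≤ ‖A - P‖ * (‖B‖ * ‖A‖) + ‖P‖ * (‖B - P'‖ * ‖A‖) + ‖P‖ * ‖P'‖ * ‖A - P‖ := by
            refine (norm_add₃_le).trans ?_
            gcongr
            · exact (norm_mul_le _ _).trans (by gcongr; exact norm_mul_le _ _)
            · exact (norm_mul_le _ _).trans (by gcongr; exact norm_mul_le _ _)
            · exact (norm_mul_le _ _).trans (by gcongr; exact norm_mul_le _ _)
        _ ≤ ε t * (1 * 1) + 1 * (ε t * 1) + 1 * 1 * ε t := by gcongr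
        _ = 3 * ε t := by ring
    have h2 : ‖((A * B * A) ^ r t) (v t) - (compression (L t) (L' t) ^ r t) (v t)‖ ≤ δ t / 2 := by
      rw [← sub_apply]
      calc _ ≤ ‖(A * B * A) ^ r t - compression (L t) (L' t) ^ r t‖ * ‖v t‖ :=
            ContinuousLinearMap.le_opNorm _ _
        _ ≤ (r t * (3 * ε t)) * ‖v t‖ := by
            gcongr
            refine (norm_pow_sub_pow_le hABA (norm_compression_le _ _) _).trans ?_
            gcongr
        _ ≤ ((r t + 1) * (3 * ε t)) * (‖v t‖ + 1) := by
            have := (hε t).le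
            gcongr <;> linarith
        _ = δ t / 2 := by
            have : ‖v t‖ + 1 ≠ 0 := by positivity
            simp only [ε]; field_simp; ring
    calc _ ≤ _ := norm_sub_le_norm_sub_add_norm_sub _
          ((compression (L t) (L' t) ^ r t) (v t)) _
      _ ≤ δ t := by linarith [hr t]

end Words

/-! ### Two enumerations of the times -/

section Combinatorics

/-- The dyadic stage of time `t`; the clock starts at `16`. -/
def stage (t : ℕ) : ℕ := Nat.log 2 (t + 16)

theorem two_pow_stage_le (t : ℕ) : 2 ^ stage t ≤ t + 16 := Nat.pow_log_le_self 2 (by omega)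

theorem lt_two_pow_stage (t : ℕ) : t + 16 < 2 * 2 ^ stage t := by
  rw [← pow_succ']; exact Nat.lt_pow_succ_log_self one_lt_two _

theorem stage_eq {t m : ℕ} (h1 : 2 ^ m ≤ t + 16) (h2 : t + 16 < 2 ^ (m + 1)) : stage t = m :=
  Nat.log_eq_of_pow_le_of_lt_pow h1 h2

theorem stage_mono {s t : ℕ} (h : s ≤ t) : stage s ≤ stage t := Nat.log_mono_right (by omega)

theorem stage_zero : stage 0 = 4 := stage_eq (by norm_num) (by norm_num)

/-- An enumeration running upwards through the stages of parity `e`, and backwards through the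
stages of the other parity, each of these coming after the next stage of parity `e`. -/
def zigzag (e t : ℕ) : ℕ := if stage t % 2 = e then t + 16 else 8 * 2 ^ stage t - (t + 16)

/-- The backward copy of stage m occupies (6·2^m, 7·2^m], in the gap between the forward stages m +
1, below 4·2^m, and m + 3, from 8·2^m on. -/
theorem zigzag_injective (e : ℕ) : (zigzag e).Injective := by
  intro a b
  wlog hab : stage a ≤ stage b generalizing a b
  · exact fun h => (this (le_of_not_ge hab) h.symm).symm
  intro h
  have ha := two_pow_stage_le a
  have hb := two_pow_stage_le b
  have ha' := lt_two_pow_stage a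
  have hb' := lt_two_pow_stage b
  unfold zigzag at h
  rcases hab.eq_or_lt with heq | hlt
  · rw [heq] at h ha ha'
    split_ifs at h <;> omega
  · obtain ⟨d, hd⟩ := Nat.exists_eq_add_of_lt hlt
    rw [hd] at h hb hb'
    have hpos : 0 < 2 ^ stage a := by positivity
    rcases d with _ | _ | d
    · rw [show 2 ^ (stage a + 0 + 1) = 2 * 2 ^ stage a by ring] at h hb hb'
      split_ifs at h <;> omega
    · rw [show 2 ^ (stage a + (0 + 1) + 1) = 4 * 2 ^ stage a by ring] at h hb hb'
      split_ifs at h <;> omega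
    · have h8 : 8 * 2 ^ stage a ≤ 2 ^ (stage a + (d + 1 + 1) + 1) := by
        rw [show (8 : ℕ) = 2 ^ 3 by norm_num, ← pow_add]
        exact Nat.pow_le_pow_right two_pos (by omega)
      generalize 2 ^ (stage a + (d + 1 + 1) + 1) = N at *
      split_ifs at h <;> omega

/-- Within one stage the two enumerations run in opposite directions. An index of an earlier stage,
or of the next one, precedes `t` in the enumeration where its own stage runs forward. -/
theorem eq_of_zigzag_le {i t : ℕ} (h0 : zigzag 0 t ≤ zigzag 0 i) (h1 : zigzag 1 t ≤ zigzag 1 i)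
    (hi : stage i < stage t + 2) : i = t := by
  have ha := two_pow_stage_le i
  have hb := two_pow_stage_le t
  have ha' := lt_two_pow_stage i
  have hb' := lt_two_pow_stage t
  unfold zigzag at h0 h1
  rcases lt_trichotomy (stage i) (stage t) with hlt | heq | hgt
  · have h2 : 2 * 2 ^ stage i ≤ 2 ^ stage t := by
      rw [← pow_succ']
      exact Nat.pow_le_pow_right two_pos hlt
    generalize 2 ^ stage i = M at *
    generalize 2 ^ stage t = N at *
    split_ifs at h0 h1 <;> omega
  · rw [heq] at h0 h1 ha ha'
    split_ifs at h0 h1 <;> omega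
  · have h2 : stage i = stage t + 1 := by omega
    rw [h2, pow_succ] at h0 h1 ha ha'
    split_ifs at h0 h1 <;> omega

/-- The second chain will omit the condition at time 0, so the first has to supply it. -/
theorem zigzag_zero_lt {t : ℕ} (ht : t ≠ 0) : zigzag 0 0 < zigzag 0 t := by
  have hb := two_pow_stage_le t
  have hb' := lt_two_pow_stage t
  have h4 : 2 ^ 4 ≤ 2 ^ stage t :=
    Nat.pow_le_pow_right two_pos (stage_zero ▸ stage_mono (Nat.zero_le t))
  unfold zigzag
  rw [stage_zero]
  split_ifs <;> omega

end Combinatorics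

/-! ### The rotation and its loss of length -/

section Angles

/-- The angle at time `t` of the vector rotating through a quarter circle in every stage. -/
noncomputable def angle (t : ℕ) : ℝ := Real.pi / 2 * ((t + 16 : ℝ) / 2 ^ stage t - 1)

/-- Coordinates of the rotating unit vector. -/
noncomputable def rotCoord (t n : ℕ) : ℝ :=
  if n = stage t then Real.cos (angle t) else if n = stage t + 1 then Real.sin (angle t) else 0

theorem rotCoord_stage (t : ℕ) : rotCoord t (stage t) = Real.cos (angle t) := if_pos rfl

theorem rotCoord_stage_add_one (t : ℕ) : rotCoord t (stage t + 1) = Real.sin (angle t) := by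
  simp [rotCoord]

theorem stage_le_of_rotCoord_ne_zero {t n : ℕ} (h : rotCoord t n ≠ 0) : stage t ≤ n := by
  unfold rotCoord at h
  split_ifs at h <;> first | omega | exact absurd rfl h

theorem angle_of_eq {t : ℕ} (h : t + 16 = 2 ^ stage t) : angle t = 0 := by
  have : (t + 16 : ℝ) = 2 ^ stage t := by exact_mod_cast h
  rw [angle, this, div_self (by positivity), sub_self, mul_zero]

/-- The inner product of the rotating unit vector at times `s` and `t`. -/
noncomputable def rotInner (s t : ℕ) : ℝ :=
  Real.cos (angle s) * rotCoord t (stage s) + Real.sin (angle s) * rotCoord t (stage s + 1)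

theorem rotInner_self (t : ℕ) : rotInner t t = 1 := by
  rw [rotInner, rotCoord_stage, rotCoord_stage_add_one]
  nlinarith [Real.sin_sq_add_cos_sq (angle t)]

/-- The step angle is the same across the end of a stage, since the quarter turn ends at the basis
vector where the next stage starts. -/
theorem rotInner_succ (t : ℕ) : rotInner t (t + 1) = Real.cos (Real.pi / 2 / 2 ^ stage t) := by
  have hb := two_pow_stage_le t
  have hb' := lt_two_pow_stage t
  have hne : (2 : ℝ) ^ stage t ≠ 0 := by positivity
  rcases Nat.lt_or_ge (t + 1 + 16) (2 * 2 ^ stage t) with hlt | hge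
  · have hs : stage (t + 1) = stage t := stage_eq (by omega) (by rw [pow_succ']; omega)
    rw [rotInner, ← hs, rotCoord_stage, rotCoord_stage_add_one, hs]
    have := Real.cos_sub (angle (t + 1)) (angle t)
    rw [mul_comm (Real.cos (angle t)), mul_comm (Real.sin (angle t)), ← this]
    refine congrArg Real.cos ?_
    rw [angle, angle, hs]
    push_cast
    field_simp
    ring
  · have heq : t + 1 + 16 = 2 ^ (stage t + 1) := by rw [pow_succ']; omega
    have hs : stage (t + 1) = stage t + 1 := stage_eq heq.ge (by rw [heq, pow_succ 2]; omega)
    have h0 : angle (t + 1) = 0 := angle_of_eq (by rw [hs, heq])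
    rw [rotInner, ← hs, rotCoord_stage, h0, Real.cos_zero, mul_one]
    have h1 : rotCoord (t + 1) (stage t) = 0 := by
      unfold rotCoord; rw [if_neg (by omega), if_neg (by omega)]
    rw [h1, mul_zero, zero_add, ← Real.cos_pi_div_two_sub]
    refine congrArg Real.cos ?_
    have heq' : (t + 16 : ℝ) = 2 * 2 ^ stage t - 1 := by
      have : ((t + 1 + 16 : ℕ) : ℝ) = ((2 ^ (stage t + 1) : ℕ) : ℝ) := congrArg _ heq
      push_cast at this
      rw [pow_succ] at this
      linarith
    rw [angle, heq']
    field_simp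
    ring

theorem one_sub_le_rotInner_succ (t : ℕ) : 1 - 5 / (t + 17 : ℝ) ^ 2 ≤ rotInner t (t + 1) := by
  rw [rotInner_succ]
  refine le_trans ?_ (Real.one_sub_sq_div_two_le_cos)
  have hN : (0 : ℝ) < 2 ^ stage t := by positivity
  have h1 : (t + 17 : ℝ) ≤ 2 * 2 ^ stage t := by exact_mod_cast lt_two_pow_stage t
  have h2 : Real.pi / 2 / 2 ^ stage t ≤ Real.pi / (t + 17 : ℝ) := by
    rw [div_div]
    exact div_le_div_of_nonneg_left Real.pi_pos.le (by positivity) h1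
  have h3 : (Real.pi / 2 / 2 ^ stage t) ^ 2 ≤ (Real.pi / (t + 17 : ℝ)) ^ 2 := by
    exact pow_le_pow_left₀ (div_nonneg (div_nonneg Real.pi_pos.le zero_le_two) hN.le) h2 2
  have h4 : (Real.pi / (t + 17 : ℝ)) ^ 2 ≤ 10 / (t + 17 : ℝ) ^ 2 := by
    rw [div_pow]
    refine div_le_div_of_nonneg_right ?_ (sq_nonneg _)
    exact (pow_le_pow_left₀ Real.pi_pos.le Real.pi_lt_d2.le 2).trans (by norm_num)
  have h5 : (10 : ℝ) / (t + 17 : ℝ) ^ 2 = 2 * (5 / (t + 17 : ℝ) ^ 2) := by ring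
  linarith

/-- The factor by which the rotating vector shrinks in the step from time `t` to `t + 1`. -/
noncomputable def shrink (t : ℕ) : ℝ := rotInner t (t + 1) / (1 + (1 / (t + 17 : ℝ)) ^ 2)

/-- The length at time `t` of the rotating vector. -/
noncomputable def rotLength (t : ℕ) : ℝ := ∏ s ∈ Finset.range t, shrink s

theorem rotLength_succ (t : ℕ) : rotLength (t + 1) = rotLength t * shrink t :=
  Finset.prod_range_succ _ _

theorem half_le_rotLength (t : ℕ) : 1 / 2 ≤ rotLength t := by
  have hpos : ∀ t : ℕ, (0 : ℝ) < t + 16 := fun t => by positivity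
  have hshrink : ∀ t : ℕ, 1 - 6 / (t + 17 : ℝ) ^ 2 ≤ shrink t := by
    intro t
    have h0 : (0 : ℝ) < t + 17 := by positivity
    rw [shrink, le_div_iff₀ (by positivity)]
    refine le_trans ?_ (one_sub_le_rotInner_succ t)
    rw [div_pow, one_pow]
    have hx : 0 ≤ 1 / (t + 17 : ℝ) ^ 2 := by positivity
    rw [show (6 : ℝ) / (t + 17 : ℝ) ^ 2 = 6 * (1 / (t + 17 : ℝ) ^ 2) by ring,
      show (5 : ℝ) / (t + 17 : ℝ) ^ 2 = 5 * (1 / (t + 17 : ℝ) ^ 2) by ring]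
    nlinarith [mul_nonneg hx hx]
  -- A step loses at most 6/(t+17)², which is below 6/(t+16) - 6/(t+17). The clock offset 16 lets
  -- the invariant start, as 1/2 + 6/16 ≤ 1.
  have key : ∀ t : ℕ, 1 / 2 + 6 / (t + 16 : ℝ) ≤ rotLength t ∧ rotLength t ≤ 1 := by
    intro t
    induction t with
    | zero => norm_num [rotLength]
    | succ t ih =>
      have h0 : (0 : ℝ) < t + 17 := by positivity
      have hle1 : shrink t ≤ 1 := by
        rw [shrink, div_le_one (by positivity), rotInner_succ]
        exact (Real.cos_le_one _).trans (le_add_of_nonneg_right (by positivity))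
      have hp : 0 ≤ rotLength t := by
        have : 0 < 6 / (t + 16 : ℝ) := div_pos (by norm_num) (hpos t)
        linarith [ih.1]
      rw [rotLength_succ]
      refine ⟨?_, ?_⟩
      · have h1 : rotLength t - 6 / (t + 17 : ℝ) ^ 2 ≤ rotLength t * shrink t := by
          have h2 := mul_le_mul_of_nonneg_left (hshrink t) hp
          have h3 : rotLength t * (6 / (t + 17 : ℝ) ^ 2) ≤ 1 * (6 / (t + 17 : ℝ) ^ 2) := by
            gcongr
            exact ih.2
          nlinarith
        have h4 : 6 / (t + 17 : ℝ) + 6 / (t + 17 : ℝ) ^ 2 ≤ 6 / (t + 16 : ℝ) := by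
          have := hpos t
          rw [div_add_div _ _ (by positivity) (by positivity),
            div_le_div_iff₀ (by positivity) (by positivity)]
          nlinarith [pow_pos h0 2]
        push_cast
        rw [show (t : ℝ) + 1 + 16 = t + 17 by ring]
        linarith [ih.1]
      · calc rotLength t * shrink t ≤ 1 * 1 := by
              refine mul_le_mul ih.2 hle1 ?_ zero_le_one
              refine le_trans ?_ (hshrink t)
              rw [sub_nonneg, div_le_one (by positivity)]
              nlinarith [(Nat.cast_nonneg t : (0 : ℝ) ≤ t)]
          _ = 1 := one_mul 1
  refine le_trans ?_ (key t).1
  have : 0 < 6 / (t + 16 : ℝ) := div_pos (by norm_num) (hpos t)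
  linarith

end Angles

/-! ### The rotating vectors in a Hilbert space -/

section Model

variable {𝕜 : Type*} [RCLike 𝕜] {V : Type*} [NormedAddCommGroup V] [InnerProductSpace 𝕜 V]

/-- The rotating vector, made linearly independent of the others by a small private component. -/
noncomputable def rotVec (b : HilbertBasis (Fin 3 × ℕ) 𝕜 V) (t : ℕ) : V :=
  (Real.cos (angle t) : 𝕜) • b (0, stage t) + (Real.sin (angle t) : 𝕜) • b (0, stage t + 1) +
    ((1 / (t + 16 : ℝ) : ℝ) : 𝕜) • b (1, t)

variable (b : HilbertBasis (Fin 3 × ℕ) 𝕜 V)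

theorem inner_basis_eq (i j : Fin 3 × ℕ) : inner 𝕜 (b i) (b j) = if i = j then 1 else 0 :=
  orthonormal_iff_ite.1 b.orthonormal i j

theorem inner_rotVec (t : ℕ) (x : V) :
    inner 𝕜 (rotVec b t) x = (Real.cos (angle t) : 𝕜) * inner 𝕜 (b (0, stage t)) x +
      (Real.sin (angle t) : 𝕜) * inner 𝕜 (b (0, stage t + 1)) x +
      ((1 / (t + 16 : ℝ) : ℝ) : 𝕜) * inner 𝕜 (b (1, t)) x := by
  simp only [rotVec, inner_add_left, inner_smul_left, RCLike.conj_ofReal]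

theorem inner_zero_rotVec (n t : ℕ) : inner 𝕜 (b (0, n)) (rotVec b t) = (rotCoord t n : 𝕜) := by
  simp only [rotVec, inner_add_right, inner_smul_right, inner_basis_eq, Prod.mk.injEq, true_and,
    rotCoord]
  split_ifs <;> first | omega | simp

theorem inner_one_rotVec (i t : ℕ) :
    inner 𝕜 (b (1, i)) (rotVec b t) = if i = t then ((1 / (t + 16 : ℝ) : ℝ) : 𝕜) else 0 := by
  simp [rotVec, inner_add_right, inner_smul_right, inner_basis_eq]

theorem inner_two_rotVec (n t : ℕ) : inner 𝕜 (b (2, n)) (rotVec b t) = 0 := by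
  simp [rotVec, inner_add_right, inner_smul_right, inner_basis_eq]

theorem inner_rotVec_rotVec (s t : ℕ) : inner 𝕜 (rotVec b s) (rotVec b t) =
    ((rotInner s t + if s = t then (1 / (t + 16 : ℝ)) ^ 2 else 0 : ℝ) : 𝕜) := by
  rw [inner_rotVec, inner_zero_rotVec, inner_zero_rotVec, inner_one_rotVec, rotInner]
  split_ifs with h
  · subst h; push_cast; ring
  · push_cast; ring

theorem norm_rotVec_sq (t : ℕ) : ‖rotVec b t‖ ^ 2 = 1 + (1 / (t + 16 : ℝ)) ^ 2 := by
  rw [← @inner_self_eq_norm_sq 𝕜, inner_rotVec_rotVec, if_pos rfl, rotInner_self, RCLike.ofReal_re]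

/-- The functional whose vanishing expresses the `n`-th coordinate in the plane part through the
private coordinates, as is the case for all vectors `rotVec b t`. -/
noncomputable def tieFunctional (n : ℕ) : V →L[𝕜] 𝕜 :=
  innerSL 𝕜 (b (0, n)) - ∑ i ∈ Finset.range (2 * 2 ^ n),
    ((rotCoord i n * (i + 16) : ℝ) : 𝕜) • innerSL 𝕜 (b (1, i))

/-- The closed linear span of the rotating vectors, given by equations. -/
noncomputable def rotSpace : ClosedSubmodule 𝕜 V :=
  (⨅ n, (⊥ : ClosedSubmodule 𝕜 𝕜).comap (innerSL 𝕜 (b (2, n)))) ⊓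
    ⨅ n, (⊥ : ClosedSubmodule 𝕜 𝕜).comap (tieFunctional b n)

/-- The factor i + 16 undoes the size 1/(i + 16) of the private component: it recovers the
coefficient of `rotVec b i` in a linear combination. -/
theorem mem_rotSpace {x : V} : x ∈ rotSpace b ↔ (∀ n, inner 𝕜 (b (2, n)) x = 0) ∧
    ∀ n, inner 𝕜 (b (0, n)) x = ∑ i ∈ Finset.range (2 * 2 ^ n),
      ((rotCoord i n * (i + 16) : ℝ) : 𝕜) * inner 𝕜 (b (1, i)) x := by
  rw [rotSpace, ClosedSubmodule.mem_inf, ClosedSubmodule.mem_iInf, ClosedSubmodule.mem_iInf]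
  refine and_congr Iff.rfl (forall_congr' fun n => ?_)
  rw [ClosedSubmodule.mem_comap, ClosedSubmodule.mem_bot, tieFunctional, sub_apply, sub_eq_zero]
  simp

/-- Only stages up to n meet coordinate n, so the finite sums in `tieFunctional` miss nothing. -/
theorem mem_range_of_rotCoord_ne_zero {i n : ℕ} (h : rotCoord i n ≠ 0) :
    i ∈ Finset.range (2 * 2 ^ n) := by
  have h1 := lt_two_pow_stage i
  have h2 : 2 ^ stage i ≤ 2 ^ n :=
    Nat.pow_le_pow_right two_pos (stage_le_of_rotCoord_ne_zero h)
  rw [Finset.mem_range]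
  omega

/-- If the private coordinates of `x ∈ rotSpace b` other than the one at time `t` do not
contribute, then `x` looks like a multiple of `rotVec b t`. -/
theorem inner_zero_of_mem_rotSpace {x : V} (hx : x ∈ rotSpace b) {n t : ℕ}
    (h : ∀ i, i ≠ t → stage i ≤ n → inner 𝕜 (b (1, i)) x = 0) :
    inner 𝕜 (b (0, n)) x = (rotCoord t n : 𝕜) * ((t + 16 : ℝ) : 𝕜) * inner 𝕜 (b (1, t)) x := by
  rw [((mem_rotSpace b).1 hx).2 n, Finset.sum_eq_single t]
  · push_cast; ring
  · intro i _ hi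
    by_cases h0 : rotCoord i n = 0
    · simp [h0]
    · rw [h i hi (stage_le_of_rotCoord_ne_zero h0), mul_zero]
  · intro ht
    have h0 : rotCoord t n = 0 := by
      by_contra h0
      exact ht (mem_range_of_rotCoord_ne_zero h0)
    simp [h0]

theorem rotVec_mem_rotSpace (t : ℕ) : rotVec b t ∈ rotSpace b := by
  refine (mem_rotSpace b).2 ⟨fun n => inner_two_rotVec b n t, fun n => ?_⟩
  have hne : (t + 16 : ℝ) ≠ 0 := by positivity
  rw [inner_zero_rotVec, Finset.sum_eq_single t]
  · rw [inner_one_rotVec, if_pos rfl, ← RCLike.ofReal_mul]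
    congr 1
    field_simp
  · intro i _ hi
    rw [inner_one_rotVec, if_neg hi, mul_zero]
  · intro ht
    have h0 : rotCoord t n = 0 := by
      by_contra h0
      exact ht (mem_range_of_rotCoord_ne_zero h0)
    simp [h0]

theorem eq_smul_rotVec_zero {y : V} (hyE : y ∈ rotSpace b)
    (h1 : ∀ i, i ≠ 0 → inner 𝕜 (b (1, i)) y = 0) :
    y = (16 * inner 𝕜 (b (1, 0)) y) • rotVec b 0 := by
  have h2 : ∀ i, inner 𝕜 (b i) y =
      inner 𝕜 (b i) ((16 * inner 𝕜 (b (1, 0)) y) • rotVec b 0) := by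
    rintro ⟨k, n⟩
    rw [inner_smul_right]
    fin_cases k
    · change inner 𝕜 (b (0, n)) y = _ * inner 𝕜 (b (0, n)) _
      rw [inner_zero_of_mem_rotSpace b hyE fun i hi _ => h1 i hi, inner_zero_rotVec]
      push_cast
      ring
    · change inner 𝕜 (b (1, n)) y = _ * inner 𝕜 (b (1, n)) _
      rw [inner_one_rotVec]
      split_ifs with h0
      · subst h0
        push_cast
        have : (16 : 𝕜) ≠ 0 := by norm_num
        field_simp
        ring
      · rw [h1 n h0, mul_zero]
    · change inner 𝕜 (b (2, n)) y = _ * inner 𝕜 (b (2, n)) _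
      rw [inner_two_rotVec, mul_zero]
      exact ((mem_rotSpace b).1 hyE).1 n
  refine b.repr.injective (lp.ext (funext fun i => ?_))
  rw [b.repr_apply_apply, b.repr_apply_apply, h2 i]

/-- The rotating vector, scaled to the length which is left after the projections. -/
noncomputable def scaledRotVec (t : ℕ) : V := (rotLength t : 𝕜) • rotVec b t

/-- The starting vectors of two consecutive stages are orthogonal, and each has length at least 1/2.
-/
theorem exists_scaledRotVec_separated (N : ℕ) :
    ∃ m ≥ N, ∃ n ≥ N, 1 / 2 ≤ ‖scaledRotVec b m - scaledRotVec b n‖ := by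
  have hstage : ∀ k, ∃ t, stage t = k + 4 ∧ angle t = 0 ∧ k ≤ t := by
    intro k
    have h16 : 2 ^ (k + 4) = 16 * 2 ^ k := by ring
    have hk : k < 2 ^ k := Nat.lt_two_pow_self
    have h1 : stage (2 ^ (k + 4) - 16) = k + 4 :=
      stage_eq (by omega) (by rw [pow_succ 2 (k + 4)]; omega)
    exact ⟨_, h1, angle_of_eq (by rw [h1]; omega), by omega⟩
  obtain ⟨m, hs, ha, hle⟩ := hstage N
  obtain ⟨n, hs', ha', hle'⟩ := hstage (N + 1)
  refine ⟨m, by omega, n, by omega, ?_⟩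
  have hmn : m ≠ n := by
    intro h
    rw [h, hs'] at hs
    omega
  have horth : inner 𝕜 (scaledRotVec b m) (scaledRotVec b n) = 0 := by
    have : rotInner m n = 0 := by
      rw [rotInner, ha, Real.sin_zero, zero_mul, rotCoord, if_neg (by omega),
        if_neg (by omega), mul_zero, add_zero]
    simp only [scaledRotVec, inner_smul_left, inner_smul_right]
    rw [inner_rotVec_rotVec, this, if_neg hmn]
    simp
  have hvm : 1 / 4 ≤ ‖scaledRotVec b m‖ ^ 2 := by
    simp only [scaledRotVec]
    rw [norm_smul, mul_pow, norm_rotVec_sq, RCLike.norm_ofReal, sq_abs]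
    calc (1 / 4 : ℝ) = (1 / 2) ^ 2 * 1 := by norm_num
      _ ≤ _ := mul_le_mul (pow_le_pow_left₀ (by norm_num) (half_le_rotLength m) 2)
        (le_add_of_nonneg_right (sq_nonneg _)) zero_le_one (sq_nonneg _)
  have h4 : ‖scaledRotVec b m - scaledRotVec b n‖ ^ 2 =
      ‖scaledRotVec b m‖ ^ 2 + ‖scaledRotVec b n‖ ^ 2 := by
    rw [@norm_sub_sq 𝕜, horth]
    simp
  by_contra! hlt
  nlinarith [norm_nonneg (scaledRotVec b m - scaledRotVec b n), sq_nonneg ‖scaledRotVec b n‖]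

variable [CompleteSpace V]

/-- The projection of `rotVec b t` onto a subspace all of whose elements look like multiples of
`rotVec b (t + 1)` up to the stage of `t + 1`. -/
theorem projOp_rotVec {W : ClosedSubmodule 𝕜 V} {t : ℕ} (hW : ∀ x ∈ W, x ∈ rotSpace b)
    (hmem : rotVec b (t + 1) ∈ W)
    (h : ∀ x ∈ W, ∀ i, i ≠ t + 1 → stage i < stage (t + 1) + 2 → inner 𝕜 (b (1, i)) x = 0) :
    projOp W (rotVec b t) = (shrink t : 𝕜) • rotVec b (t + 1) := by
  refine projOp_eq (W.smul_mem _ hmem) fun x hx => ?_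
  have hst : stage t ≤ stage (t + 1) := stage_mono (Nat.le_succ t)
  have hcoord : ∀ n ≤ stage (t + 1) + 1, inner 𝕜 (b (0, n)) x =
      (rotCoord (t + 1) n : 𝕜) * (((t + 1 : ℕ) + 16 : ℝ) : 𝕜) * inner 𝕜 (b (1, t + 1)) x :=
    fun n hn => inner_zero_of_mem_rotSpace b (hW x hx) fun i hi his => h x hx i hi (by omega)
  -- On the coordinates that `rotVec b s` uses, x agrees with a multiple of `rotVec b (t + 1)`, so
  -- `W` acts like a line although it may be large.
  have key : ∀ s, stage s ≤ stage (t + 1) → inner 𝕜 (rotVec b s) x =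
      inner 𝕜 (rotVec b s) (rotVec b (t + 1)) *
        ((((t + 1 : ℕ) + 16 : ℝ) : 𝕜) * inner 𝕜 (b (1, t + 1)) x) := by
    intro s hs
    have hne : (((t + 1 : ℕ) + 16 : ℝ) : 𝕜) ≠ 0 := by
      have : ((t + 1 : ℕ) + 16 : ℝ) ≠ 0 := by positivity
      exact_mod_cast this
    rw [inner_rotVec, inner_rotVec, hcoord _ (by omega), hcoord _ (by omega), inner_zero_rotVec,
      inner_zero_rotVec, inner_one_rotVec]
    split_ifs with h1
    · subst h1
      rw [RCLike.ofReal_div, RCLike.ofReal_one]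
      field_simp
    · rw [h x hx s h1 (by omega)]
      ring
  -- This number, the denominator of `shrink t`, is the squared norm of `rotVec b (t + 1)`.
  have hnorm : (1 + (1 / (t + 17 : ℝ)) ^ 2) ≠ 0 := by positivity
  rw [inner_sub_left, inner_smul_left, RCLike.conj_ofReal, key t hst, key (t + 1) le_rfl,
    inner_rotVec_rotVec, inner_rotVec_rotVec, if_neg (by omega), if_pos rfl, rotInner_self,
    ← mul_assoc (shrink t : 𝕜), ← sub_mul, ← RCLike.ofReal_mul, ← RCLike.ofReal_sub, shrink]
  have h17 : ((t + 1 : ℕ) + 16 : ℝ) = t + 17 := by push_cast; ring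
  rw [h17, div_mul_cancel₀ _ hnorm, add_zero, sub_self, RCLike.ofReal_zero, zero_mul]

/-- Subspaces `X i` and a bounded, wandering sequence `v` such that suitable products of the
projections map `v t` almost to `v (t + 1)`, and such that the projection onto the line through
`v 0` is a strong limit of products of the projections. -/
theorem exists_wandering_sequence (b : HilbertBasis (Fin 3 × ℕ) 𝕜 V) :
    ∃ (X : Fin 3 → ClosedSubmodule 𝕜 V) (v : ℕ → V),
    (∀ t, v t ∈ X 0) ∧ v 0 ≠ 0 ∧
    (∀ x, ∃ a : 𝕜, (inner 𝕜 (v 0) x ≠ 0 → a ≠ 0) ∧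
      Tendsto (fun n => (compression (X 0) (X 2) ^ n) x) atTop (𝓝 (a • v 0))) ∧
    (∀ t, ∃ W ∈ projWords X, ‖W (v t) - v (t + 1)‖ ≤ 1 / 32 / 2 ^ t) ∧
    ∀ N, ∃ m ≥ N, ∃ n ≥ N, 1 / 2 ≤ ‖v m - v n‖ := by
  let E := rotSpace b
  let p : ℕ → V := fun i => b (1, i)
  -- Dropping the condition at time 0 makes `E ⊓ Y'` the line through `v 0`.
  let p' : ℕ → V := fun i => if i = 0 then 0 else b (1, i)
  let cut : (ℕ → V) → ℕ → ℕ → ClosedSubmodule 𝕜 V := fun q e t => E ⊓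
    ⨅ i, ⨅ _ : zigzag e i < zigzag e t, (⊥ : ClosedSubmodule 𝕜 𝕜).comap (innerSL 𝕜 (q i))
  have hcut : ∀ q e t x, x ∈ cut q e t ↔
      x ∈ E ∧ ∀ i, zigzag e i < zigzag e t → inner 𝕜 (q i) x = 0 := by
    intro q e t x
    simp only [cut, ClosedSubmodule.mem_inf, ClosedSubmodule.mem_iInf]
    rfl
  have hEf : ∀ n, projOp E (b (2, n)) = 0 := fun n =>
    projOp_eq (zero_mem _) fun z hz => by
      rw [sub_zero]; exact ((mem_rotSpace b).1 hz).1 n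
  have hf : Orthonormal 𝕜 fun n => b (2, n) :=
    b.orthonormal.comp (fun n => ((2 : Fin 3), n)) fun m n h => by simpa using h
  have hwin : ∀ t, t ≠ 0 → ∀ x ∈ cut p 0 t ⊓ cut p' 1 t, ∀ i, i ≠ t → stage i < stage t + 2 →
      inner 𝕜 (b (1, i)) x = 0 := by
    intro t ht x hx i hit his
    have h0 := ((hcut _ _ _ _).1 hx.1).2 i
    have h1 := ((hcut _ _ _ _).1 hx.2).2 i
    by_contra hne
    have h0' : zigzag 0 t ≤ zigzag 0 i := not_lt.1 fun h => hne (h0 h)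
    have hi0 : i ≠ 0 := by
      rintro rfl
      exact absurd (zigzag_zero_lt ht) (not_lt.2 h0')
    have h1' : zigzag 1 t ≤ zigzag 1 i := not_lt.1 fun h => hne (by
      have := h1 h
      simp only [p', if_neg hi0] at this
      exact this)
    exact hit (eq_of_zigzag_le h0' h1' his)
  have hmem : ∀ q e t, (∀ i, i ≠ t → inner 𝕜 (q i) (rotVec b t) = 0) →
      rotVec b t ∈ cut q e t := by
    intro q e t h
    refine (hcut _ _ _ _).2 ⟨rotVec_mem_rotSpace b t, fun i hi => h i ?_⟩
    rintro rfl
    exact lt_irrefl _ hi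
  have hp : ∀ t i, i ≠ t → inner 𝕜 (p i) (rotVec b t) = 0 := fun t i hi => by
    simp only [p, inner_one_rotVec, if_neg hi]
  have hp' : ∀ t i, i ≠ t → inner 𝕜 (p' i) (rotVec b t) = 0 := fun t i hi => by
    by_cases h0 : i = 0
    · simp [p', h0]
    · simp only [p', if_neg h0, inner_one_rotVec, if_neg hi]
  have hproj : ∀ t, projOp (cut p 0 (t + 1) ⊓ cut p' 1 (t + 1)) (rotVec b t) =
      (shrink t : 𝕜) • rotVec b (t + 1) := fun t =>
    projOp_rotVec b (fun x hx => hx.1.1) ⟨hmem _ _ _ (hp _), hmem _ _ _ (hp' _)⟩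
      (hwin (t + 1) (Nat.succ_ne_zero t))
  let v : ℕ → V := scaledRotVec b
  have hv : ∀ t, projOp (cut p 0 (t + 1) ⊓ cut p' 1 (t + 1)) (v t) = v (t + 1) := by
    intro t
    simp only [v, scaledRotVec]
    rw [map_smul, hproj, smul_smul, rotLength_succ, RCLike.ofReal_mul]
  have hv0 : v 0 = rotVec b 0 := by simp [v, scaledRotVec, rotLength]
  -- The chain members at t + 1 act on `v t`, hence the shift t - 1; index 0 is not used.
  obtain ⟨Y, Y', hY', hW⟩ := exists_projWords_near E hf hEf p p' (zigzag_injective 0)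
    (zigzag_injective 1) (cut p 0) (cut p' 1) (hcut p 0) (hcut p' 1) (fun t => v (t - 1))
    (δ := fun t => 1 / 32 / 2 ^ (t - 1)) (fun t => by positivity)
  have hvE : ∀ t, v t ∈ E := fun t => E.smul_mem _ (rotVec_mem_rotSpace b t)
  have hv0n : v 0 ≠ 0 := by
    intro h
    have := norm_rotVec_sq b 0
    rw [← hv0, h, norm_zero] at this
    norm_num at this
  refine ⟨![E, Y, Y'], v, hvE, hv0n, fun x => ?_, fun t => ?_, fun N => ?_⟩
  · have hline : ∀ y ∈ E ⊓ Y', y = (16 * inner 𝕜 (b (1, 0)) y) • v 0 := by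
      intro y hy
      obtain ⟨hyE, hyp⟩ := (hY' y).1 hy
      rw [hv0]
      exact eq_smul_rotVec_zero b hyE fun i hi => by
        have := hyp i
        simp only [p', if_neg hi] at this
        exact this
    have hx := tendsto_compression_pow E Y' x
    have hv0mem : v 0 ∈ E ⊓ Y' := (hY' _).2 ⟨hvE 0, fun i => by
      by_cases h0 : i = 0
      · simp [p', h0]
      · rw [hv0]; exact hp' 0 i h0⟩
    refine ⟨16 * inner 𝕜 (b (1, 0)) (projOp (E ⊓ Y') x), fun hne ha => hne ?_, ?_⟩
    swap
    · rw [← hline _ (projOp_mem (E ⊓ Y') x)]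
      exact hx
    · have h3 := hline _ (projOp_mem (E ⊓ Y') x)
      rw [ha, zero_smul] at h3
      rw [← projOp_eq_self hv0mem, projOp_symm, h3, inner_zero_right]
  · obtain ⟨W, hWm, hWn⟩ := hW (t + 1)
    refine ⟨W, hWm, ?_⟩
    rw [← hv t]
    simpa using hWn
  · exact exists_scaledRotVec_separated b N

end Model

/-! ### Concatenating finite chains -/

section Paths

/-- A finite chain of steps can be traversed along `ℕ`. -/
theorem Relation.TransGen.exists_path {α : Type*} {r : α → α → Prop} {a b : α}
    (h : Relation.TransGen r a b) :
    ∃ (n : ℕ) (p : ℕ → α), 0 < n ∧ p 0 = a ∧ p n = b ∧ ∀ i < n, r (p i) (p (i + 1)) := by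
  induction h with
  | @single c h =>
    exact ⟨1, fun i => if i = 0 then a else c, one_pos, by simp, by simp, fun i hi => by
      obtain rfl : i = 0 := by omega
      simpa using h⟩
  | @tail c d _ h ih =>
    obtain ⟨n, p, hn, h0, hpn, hp⟩ := ih
    refine ⟨n + 1, fun i => if i ≤ n then p i else d, by omega, by simpa using h0, by simp,
      fun i hi => ?_⟩
    rcases Nat.lt_or_ge i n with hlt | hge
    · simpa [hlt.le, Nat.succ_le_of_lt hlt] using hp i hlt
    · obtain rfl : i = n := by omega
      simpa [hpn] using h

/-- Infinitely many finite chains of steps can be concatenated. -/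
theorem exists_path_of_transGen {α : Type*} {r : α → α → Prop} (z : ℕ → α)
    (h : ∀ t, Relation.TransGen r (z t) (z (t + 1))) :
    ∃ (w : ℕ → α) (φ : ℕ → ℕ), w 0 = z 0 ∧ (∀ n, r (w n) (w (n + 1))) ∧ StrictMono φ ∧
      ∀ t, w (φ t) = z t := by
  choose n p hn h0 hend hp using fun t => (h t).exists_path
  -- The state (t, i) is position i on the t-th chain.
  let s : ℕ → ℕ × ℕ := fun k => Nat.rec (0, 0)
    (fun _ q => if q.2 + 1 < n q.1 then (q.1, q.2 + 1) else (q.1 + 1, 0)) k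
  have hs : ∀ k, s (k + 1) =
      if (s k).2 + 1 < n (s k).1 then ((s k).1, (s k).2 + 1) else ((s k).1 + 1, 0) := fun k => rfl
  have hlt : ∀ k, (s k).2 < n (s k).1 := by
    intro k
    induction k with
    | zero => exact hn 0
    | succ k ih =>
      rw [hs]
      split_ifs with h1
      · exact h1
      · exact hn _
  let φ : ℕ → ℕ := fun t => ∑ j ∈ Finset.range t, n j
  have hφ : ∀ t, φ (t + 1) = φ t + n t := fun t => Finset.sum_range_succ _ _
  have hblock : ∀ t, s (φ t) = (t, 0) → ∀ i < n t, s (φ t + i) = (t, i) := by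
    intro t ht i hi
    induction i with
    | zero => exact ht
    | succ i ih =>
      rw [← add_assoc, hs, ih (by omega), if_pos hi]
  have hstart : ∀ t, s (φ t) = (t, 0) := by
    intro t
    induction t with
    | zero => rfl
    | succ t ih =>
      have h1 := hblock t ih (n t - 1) (by have := hn t; omega)
      have h2 : φ (t + 1) = φ t + (n t - 1) + 1 := by rw [hφ]; have := hn t; omega
      rw [h2, hs, h1, if_neg (by have := hn t; simp only; omega)]
  refine ⟨fun k => p (s k).1 (s k).2, φ, h0 0, fun k => ?_,
    strictMono_nat_of_lt_succ fun t => by rw [hφ]; have := hn t; omega, fun t => ?_⟩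
  · have h1 := hp (s k).1 (s k).2 (hlt k)
    simp only [hs]
    split_ifs with h2
    · exact h1
    · have h3 : (s k).2 + 1 = n (s k).1 := by have := hlt k; omega
      rw [h3, hend] at h1
      simpa [h0] using h1
  · simp only [hstart, h0]

end Paths

/-! ### Divergent orbits from words -/

section Orbits

variable {𝕜 : Type*} [RCLike 𝕜] {V : Type*} [NormedAddCommGroup V] [InnerProductSpace 𝕜 V]
  [CompleteSpace V]

/-- Some sequence of projections onto the subspaces `X i`, applied to `z`, diverges. -/
def HasDivergentOrbit {ι : Type*} (X : ι → ClosedSubmodule 𝕜 V) (z : V) : Prop :=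
  ∃ (k : ℕ → ι) (w : ℕ → V), w 0 = z ∧ (∀ n, w (n + 1) = projOp (X (k (n + 1))) (w n)) ∧
    ¬ ∃ l, Tendsto w atTop (𝓝 l)

/-- Divergence is reflected by continuous maps intertwining the projections. -/
theorem HasDivergentOrbit.of_intertwining {H : Type*} [NormedAddCommGroup H]
    [InnerProductSpace 𝕜 H] [CompleteSpace H] {ι : Type*} {X : ι → ClosedSubmodule 𝕜 V}
    {X' : ι → ClosedSubmodule 𝕜 H} (M : H →L[𝕜] V)
    (hM : ∀ i x, M (projOp (X' i) x) = projOp (X i) (M x)) {z : H}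
    (h : HasDivergentOrbit X (M z)) : HasDivergentOrbit X' z := by
  obtain ⟨k, w, hw0, hw, hdiv⟩ := h
  let w' : ℕ → H := fun n => Nat.rec z (fun n x => projOp (X' (k (n + 1))) x) n
  have hMw : ∀ n, M (w' n) = w n := by
    intro n
    induction n with
    | zero => exact hw0.symm
    | succ n ih => rw [hw, ← ih, ← hM]
  refine ⟨k, w', rfl, fun n => rfl, ?_⟩
  rintro ⟨l, hl⟩
  refine hdiv ⟨M l, ?_⟩
  have := (M.continuous.tendsto l).comp hl
  simpa only [Function.comp_def, hMw] using this

theorem reflTransGen_of_mem_projWords {ι : Type*} {X : ι → ClosedSubmodule 𝕜 V} {W : V →L[𝕜] V}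
    (hW : W ∈ projWords X) :
    ∀ x, Relation.ReflTransGen (fun x y => ∃ i, y = projOp (X i) x) x (W x) := by
  induction hW using Submonoid.closure_induction with
  | mem A hA =>
    obtain ⟨i, rfl⟩ := hA
    exact fun x => .single ⟨i, rfl⟩
  | one => exact fun x => .refl
  | mul A B _ _ hA hB => exact fun x => (hB x).trans (hA (B x))

theorem norm_apply_le_of_mem_projWords {ι : Type*} {X : ι → ClosedSubmodule 𝕜 V} {W : V →L[𝕜] V}
    (hW : W ∈ projWords X) : ∀ x, ‖W x‖ ≤ ‖x‖ := by
  induction hW using Submonoid.closure_induction with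
  | mem A hA =>
    obtain ⟨i, rfl⟩ := hA
    exact norm_projOp_apply_le _
  | one => exact fun x => le_rfl
  | mul A B _ _ hA hB => exact fun x => (hA (B x)).trans (hB x)

/-- The adjoint is the reversed word. It turns a vector not orthogonal to `A (v 0)` into one not
orthogonal to `v 0`. -/
theorem exists_adjoint_mem_projWords {ι : Type*} {X : ι → ClosedSubmodule 𝕜 V} {W : V →L[𝕜] V}
    (hW : W ∈ projWords X) :
    ∃ W' ∈ projWords X, ∀ x y, inner 𝕜 (W x) y = inner 𝕜 x (W' y) := by
  induction hW using Submonoid.closure_induction with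
  | mem A hA =>
    obtain ⟨i, rfl⟩ := hA
    exact ⟨_, projOp_mem_projWords X i, projOp_symm _⟩
  | one => exact ⟨1, one_mem _, fun x y => rfl⟩
  | mul A B _ _ hA hB =>
    obtain ⟨A', hA', hA⟩ := hA
    obtain ⟨B', hB', hB⟩ := hB
    refine ⟨B' * A', mul_mem hB' hA', fun x y => ?_⟩
    change inner 𝕜 (A (B x)) y = inner 𝕜 x (B' (A' y))
    rw [hA, hB]

theorem HasDivergentOrbit.of_projOp {ι : Type*} {X : ι → ClosedSubmodule 𝕜 V} {i : ι} {z : V}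
    (h : HasDivergentOrbit X (projOp (X i) z)) : HasDivergentOrbit X z := by
  obtain ⟨k, w, hw0, hw, hdiv⟩ := h
  refine ⟨fun n => Nat.casesOn (n - 1) i fun m => k (m + 1), fun n => Nat.casesOn n z w, rfl, ?_, ?_⟩
  · rintro (_ | n)
    · exact hw0
    · exact hw n
  · rintro ⟨l, hl⟩
    exact hdiv ⟨l, hl.comp (tendsto_add_atTop_nat 1)⟩

theorem HasDivergentOrbit.of_projWord {ι : Type*} {X : ι → ClosedSubmodule 𝕜 V} {W : V →L[𝕜] V}
    (hW : W ∈ projWords X) {z : V} (h : HasDivergentOrbit X (W z)) : HasDivergentOrbit X z := by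
  induction hW using Submonoid.closure_induction generalizing z with
  | mem A hA =>
    obtain ⟨i, rfl⟩ := hA
    exact h.of_projOp
  | one => exact h
  | mul A B _ _ hA hB => exact hB (hA h)

/-- A sequence of words whose orbit is not Cauchy yields a divergent orbit. -/
theorem hasDivergentOrbit_of_projWords {ι : Type*} {X : ι → ClosedSubmodule 𝕜 V} (i₀ : ι)
    (z : ℕ → V) (W : ℕ → V →L[𝕜] V) (hW : ∀ t, W t ∈ projWords X)
    (hz : ∀ t, z (t + 1) = W t (projOp (X i₀) (z t))) (hC : ¬ CauchySeq z) :
    HasDivergentOrbit X (z 0) := by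
  obtain ⟨w, φ, hw0, hw, hφ, hwφ⟩ := exists_path_of_transGen
    (r := fun x y => ∃ i, y = projOp (X i) x) z fun t => by
      rw [hz]
      -- The extra projection gives each chain positive length even if the word is empty.
      exact Relation.TransGen.head' ⟨i₀, rfl⟩ (reflTransGen_of_mem_projWords (hW t) _)
  choose k hk using hw
  refine ⟨fun n => k (n - 1), w, hw0, fun n => hk n, ?_⟩
  rintro ⟨l, hl⟩
  refine hC (Tendsto.cauchySeq (x := l) ?_)
  have := hl.comp hφ.tendsto_atTop
  simpa only [Function.comp_def, hwφ] using this

/-- Divergence of orbits for all vectors that are not orthogonal to the words applied to `v 0`,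
where `v` is a wandering sequence followed by words. -/
theorem hasDivergentOrbit_of_wandering {X : Fin 3 → ClosedSubmodule 𝕜 V} {v : ℕ → V}
    (hv0 : ∀ t, v t ∈ X 0)
    (hline : ∀ x, ∃ a : 𝕜, (inner 𝕜 (v 0) x ≠ 0 → a ≠ 0) ∧
      Tendsto (fun n => (compression (X 0) (X 2) ^ n) x) atTop (𝓝 (a • v 0)))
    (hstep : ∀ t, ∃ W ∈ projWords X, ‖W (v t) - v (t + 1)‖ ≤ 1 / 32 / 2 ^ t)
    (hsep : ∀ N, ∃ m ≥ N, ∃ n ≥ N, 1 / 2 ≤ ‖v m - v n‖) {A : V →L[𝕜] V}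
    (hA : A ∈ projWords X) {z : V} (hz : inner 𝕜 (A (v 0)) z ≠ 0) : HasDivergentOrbit X z := by
  obtain ⟨A', hA', hAA'⟩ := exists_adjoint_mem_projWords hA
  rw [hAA'] at hz
  obtain ⟨a, ha, hlim⟩ := hline (A' z)
  have ha := ha hz
  have hapos : 0 < ‖a‖ := norm_pos_iff.2 ha
  obtain ⟨n, hn⟩ := ((tendsto_iff_norm_sub_tendsto_zero.1 hlim).eventually
    (gt_mem_nhds (show 0 < ‖a‖ / 16 by positivity))).exists
  choose W hWm hW using hstep
  -- one reaches `z₁` near `a • v 0` and follows the wandering sequence from there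
  set z₁ := (compression (X 0) (X 2) ^ n) (A' z) with hz₁
  let y : ℕ → V := fun t => Nat.rec z₁ (fun t x => W t (projOp (X 0) x)) t
  have hy0 : y 0 = z₁ := rfl
  have hy : ∀ t, y (t + 1) = W t (projOp (X 0) (y t)) := fun t => rfl
  -- The initial error ‖a‖/16 and the step errors ‖a‖/32/2^t add up to at most ‖a‖/8, too little to
  -- hide the jumps of size ‖a‖/2.
  have hclose : ∀ t, ‖y t - a • v t‖ ≤ ‖a‖ * (1 / 8 - 1 / 16 / 2 ^ t) := by
    intro t
    induction t with
    | zero => rw [hy0]; norm_num; linarith [hn]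
    | succ t ih =>
      have h1 : y (t + 1) - a • v (t + 1) = W t (projOp (X 0) (y t - a • v t)) +
          a • (W t (v t) - v (t + 1)) := by
        rw [hy, map_sub, map_smul, projOp_eq_self (hv0 t), map_sub, map_smul, smul_sub]
        abel
      rw [h1]
      calc _ ≤ ‖W t (projOp (X 0) (y t - a • v t))‖ + ‖a • (W t (v t) - v (t + 1))‖ :=
            norm_add_le _ _
        _ ≤ ‖a‖ * (1 / 8 - 1 / 16 / 2 ^ t) + ‖a‖ * (1 / 32 / 2 ^ t) := by
            refine add_le_add ?_ ?_
            · exact (norm_apply_le_of_mem_projWords (hWm t) _).trans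
                ((norm_projOp_apply_le _ _).trans ih)
            · rw [norm_smul]
              exact mul_le_mul_of_nonneg_left (hW t) hapos.le
        _ = _ := by rw [pow_succ]; field_simp; ring
  have hyC : ¬ CauchySeq y := by
    intro hC
    obtain ⟨N, hN⟩ := Metric.cauchySeq_iff.1 hC (‖a‖ / 4) (by positivity)
    obtain ⟨m, hm, n, hn, hmn⟩ := hsep N
    have h1 := hN m hm n hn
    rw [dist_eq_norm] at h1
    have hle : ∀ t, ‖y t - a • v t‖ ≤ ‖a‖ / 8 := fun t => (hclose t).trans (by
      have : 0 ≤ ‖a‖ * (1 / 16 / 2 ^ t) := by positivity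
      linarith)
    have h2 : a • (v m - v n) = (y m - y n) - (y m - a • v m) + (y n - a • v n) := by
      rw [smul_sub]; abel
    have h3 : ‖a‖ * ‖v m - v n‖ ≤ ‖y m - y n‖ + ‖y m - a • v m‖ + ‖y n - a • v n‖ := by
      rw [← norm_smul, h2]
      exact (norm_add_le _ _).trans (by gcongr; exact norm_sub_le _ _)
    have h4 : ‖a‖ * (1 / 2) ≤ ‖a‖ * ‖v m - v n‖ := by gcongr
    linarith [hle m, hle n]
  refine HasDivergentOrbit.of_projWord hA' (.of_projWord
    (pow_mem (compression_mem_projWords X 0 2) n) ?_)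
  exact hasDivergentOrbit_of_projWords 0 y W hWm hy hyC

end Orbits

/-! ### Cyclic subspace and orthogonal copies -/

section Assembly

/-- Orthonormal families in separable spaces are countable. -/
theorem Orthonormal.countable_of_separableSpace {𝕜 : Type*} [RCLike 𝕜] {V : Type*}
    [NormedAddCommGroup V] [InnerProductSpace 𝕜 V] [TopologicalSpace.SeparableSpace V]
    {κ : Type*} {v : κ → V} (hv : Orthonormal 𝕜 v) : Countable κ := by
  rw [← Set.countable_univ_iff]
  refine Set.PairwiseDisjoint.countable_of_isOpen (s := fun i => Metric.ball (v i) (1 / 2))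
    (fun i _ j _ hij => ?_) (fun _ _ => Metric.isOpen_ball)
    (fun i _ => ⟨v i, Metric.mem_ball_self (by norm_num)⟩)
  refine Metric.ball_disjoint_ball ?_
  have h : dist (v i) (v j) ^ 2 = 2 := by
    rw [dist_eq_norm, @norm_sub_sq 𝕜, hv.2 hij, hv.1 i, hv.1 j]
    norm_num
  by_contra! hlt
  nlinarith [dist_nonneg (x := v i) (y := v j)]

/-- A Hilbert space with a countable basis is separable. -/
theorem HilbertBasis.separableSpace {𝕜 : Type*} [RCLike 𝕜] {V : Type*}
    [NormedAddCommGroup V] [InnerProductSpace 𝕜 V] {κ : Type*} [Countable κ]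
    (b : HilbertBasis κ 𝕜 V) : TopologicalSpace.SeparableSpace V := by
  rw [← TopologicalSpace.isSeparable_univ_iff]
  have h := (Set.countable_range b).isSeparable.span (R := 𝕜) |>.closure
  have h2 := b.dense_span
  rw [← Submodule.topologicalClosure_coe, h2] at h
  exact h

/-- In the cyclic subspace of a wandering sequence all nonzero vectors have divergent orbits. -/
theorem exists_hasDivergentOrbit {𝕜 : Type*} [RCLike 𝕜] {V : Type*} [NormedAddCommGroup V]
    [InnerProductSpace 𝕜 V] [CompleteSpace V] (b : HilbertBasis (Fin 3 × ℕ) 𝕜 V) :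
    ∃ (S : Submodule 𝕜 V) (X : Fin 3 → ClosedSubmodule 𝕜 S.topologicalClosure),
      Nontrivial S.topologicalClosure ∧ ∀ z, z ≠ 0 → HasDivergentOrbit X z := by
  obtain ⟨X, v, hv0, hne, hline, hstep, hsep⟩ := exists_wandering_sequence b
  let S : Submodule 𝕜 V := Submodule.span 𝕜 {y | ∃ A ∈ projWords X, y = A (v 0)}
  let K : Submodule 𝕜 V := S.topologicalClosure
  have hgen : ∀ A ∈ projWords X, A (v 0) ∈ K := fun A hA =>
    S.le_topologicalClosure (Submodule.subset_span ⟨A, hA, rfl⟩)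
  have hinv : ∀ i, ∀ x ∈ K, projOp (X i) x ∈ K := by
    intro i
    have h1 : K ≤ K.comap (projOp (X i)).toLinearMap := by
      refine S.topologicalClosure_minimal (Submodule.span_le.2 ?_)
        (S.isClosed_topologicalClosure.preimage (projOp (X i)).continuous)
      rintro _ ⟨A, hA, rfl⟩
      exact hgen _ (mul_mem (projOp_mem_projWords X i) hA)
    exact h1
  let XK : Fin 3 → ClosedSubmodule 𝕜 K := fun i =>
    (X i).comap K.subtypeL
  -- As `K` is invariant under the projections, their restrictions are the orthogonal projections
  -- onto the traces of the `X i` on `K`.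
  have hXK : ∀ i (x : K),
      K.subtypeL (projOp (XK i) x) = projOp (X i) (K.subtypeL x) := by
    intro i x
    have h1 : projOp (XK i) x = ⟨projOp (X i) x, hinv i x x.2⟩ :=
      projOp_eq (projOp_mem (X i) (x : V)) fun z hz =>
        Submodule.starProjection_inner_eq_zero (K := (X i).toSubmodule) (x : V) (z : V) hz
    rw [h1]
    rfl
  refine ⟨S, XK, ⟨⟨v 0, hgen 1 (one_mem _)⟩, 0, fun h => hne (congrArg Subtype.val h)⟩,
    fun z hz => ?_⟩
  refine HasDivergentOrbit.of_intertwining K.subtypeL hXK ?_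
  by_contra hdiv
  -- Without a divergent orbit, `z` is orthogonal to all generators of `K`, hence to itself.
  have horth : ∀ A ∈ projWords X, inner 𝕜 (A (v 0)) (z : V) = 0 := fun A hA => by
    by_contra h
    exact hdiv (hasDivergentOrbit_of_wandering hv0 hline hstep hsep hA h)
  have h1 : K ≤ ((⊥ : ClosedSubmodule 𝕜 𝕜).comap (innerSL 𝕜 (z : V))).toSubmodule := by
    refine S.topologicalClosure_minimal (Submodule.span_le.2 ?_) (ClosedSubmodule.isClosed _)
    rintro _ ⟨A, hA, rfl⟩
    exact inner_eq_zero_symm.1 (horth A hA)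
  have h2 : inner 𝕜 (z : V) (z : V) = 0 := h1 z.2
  exact hz (Subtype.ext (inner_self_eq_zero.1 h2))

/-- The property that all nonzero vectors have divergent orbits passes to multiples of a
separable space. -/
theorem exists_hasDivergentOrbit_of_hilbertBasis {𝕜 : Type*} [RCLike 𝕜] {K H : Type*}
    [NormedAddCommGroup K] [InnerProductSpace 𝕜 K] [CompleteSpace K] [NormedAddCommGroup H]
    [InnerProductSpace 𝕜 H] [CompleteSpace H] {ι κ μ : Type*} (bK : HilbertBasis κ 𝕜 K)
    (b : HilbertBasis (μ × κ) 𝕜 H) (X : ι → ClosedSubmodule 𝕜 K)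
    (hX : ∀ z, z ≠ 0 → HasDivergentOrbit X z) :
    ∃ X' : ι → ClosedSubmodule 𝕜 H, ∀ z, z ≠ 0 → HasDivergentOrbit X' z := by
  have hon : ∀ α : μ, Orthonormal 𝕜 fun j => b (α, j) := fun α =>
    b.orthonormal.comp (fun j => (α, j)) fun i j h => by simpa using h
  let J : μ → K →ₗᵢ[𝕜] H := fun α =>
    (hon α).orthogonalFamily.linearIsometry.comp bK.repr.toLinearIsometry
  have hJ : ∀ α j, J α (bK j) = b (α, j) := by
    classical
    intro α j
    change (hon α).orthogonalFamily.linearIsometry (bK.repr (bK j)) = _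
    rw [bK.repr_self]
    exact ((hon α).orthogonalFamily.linearIsometry_apply_single _).trans (by simp)
  let M : μ → H →L[𝕜] K := fun α => ContinuousLinearMap.adjoint (J α).toContinuousLinearMap
  have hM : ∀ α x y, inner 𝕜 (M α x) y = inner 𝕜 x (J α y) := fun α x y =>
    ContinuousLinearMap.adjoint_inner_left _ _ _
  have hbJ : ∀ α β, α ≠ β → ∀ j k, inner 𝕜 (b (α, j)) (J β k) = 0 := by
    intro α β hαβ j k
    have h1 : HasSum (fun i => inner 𝕜 (b (α, j)) (J β (bK.repr k i • bK i)))
        (inner 𝕜 (b (α, j)) (J β k)) :=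
      ((bK.hasSum_repr k).mapL (J β).toContinuousLinearMap).mapL (innerSL 𝕜 (b (α, j)))
    refine h1.unique ?_
    convert hasSum_zero with i
    rw [map_smul, hJ, inner_smul_right, b.orthonormal.2 (by simp [hαβ]), mul_zero]
  have hMJ : ∀ α β, α ≠ β → ∀ k, M α (J β k) = 0 := by
    intro α β hαβ k
    refine bK.repr.injective (lp.ext (funext fun j => ?_))
    rw [bK.repr_apply_apply, map_zero, ← inner_conj_symm, hM, hJ, inner_conj_symm, hbJ α β hαβ]
    rfl
  have hMJ' : ∀ α k, M α (J α k) = k := by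
    intro α k
    refine ext_inner_right 𝕜 fun y => ?_
    rw [hM, LinearIsometry.inner_map_map]
  -- This is the orthogonal sum of the copies of `X i`. Each component map `M α` intertwines the
  -- projections, so one nonzero component of `z` forces divergence.
  let X' : ι → ClosedSubmodule 𝕜 H := fun i => ⨅ α, (X i).comap (M α)
  have hX' : ∀ i x, x ∈ X' i ↔ ∀ α, M α x ∈ X i := fun i x => by
    simp only [X', ClosedSubmodule.mem_iInf, ClosedSubmodule.mem_comap]
  refine ⟨X', fun z hz => ?_⟩
  obtain ⟨α, hα⟩ : ∃ α, M α z ≠ 0 := by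
    by_contra! h
    refine hz (b.repr.injective (lp.ext (funext fun ⟨α, j⟩ => ?_)))
    rw [b.repr_apply_apply, map_zero, ← hJ, ← inner_conj_symm, ← hM, h]
    simp
  refine HasDivergentOrbit.of_intertwining (M α) (fun i x => ?_) (hX _ hα)
  refine (projOp_eq ((hX' i _).1 (projOp_mem (X' i) x) α) fun k hk => ?_).symm
  rw [← map_sub, hM]
  refine Submodule.starProjection_inner_eq_zero (K := (X' i).toSubmodule) x _ ((hX' i _).2 ?_)
  intro β
  by_cases hβ : β = α
  · subst hβ; rwa [hMJ']
  · rw [hMJ β α hβ]; exact zero_mem _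

end Assembly

theorem theorem3p5 {𝕜 : Type*} [RCLike 𝕜] {H : Type*} [NormedAddCommGroup H]
    [InnerProductSpace 𝕜 H] [CompleteSpace H] (hH : ¬ FiniteDimensional 𝕜 H) :
    ∃ X : Fin 3 → ClosedSubmodule 𝕜 H,
      ∀ w₀ : H, w₀ ≠ 0 →
        ∃ (k : ℕ → Fin 3) (w : ℕ → H), w 0 = w₀ ∧
          (∀ n : ℕ, w (n + 1) = (X (k (n + 1))).toSubmodule.starProjection (w n)) ∧
          ¬ ∃ l : H, Tendsto w atTop (𝓝 l) := by
  have b₀ : HilbertBasis (Fin 3 × ℕ) 𝕜 (lp (fun _ : Fin 3 × ℕ => 𝕜) 2) := default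
  have := b₀.separableSpace
  obtain ⟨S, X, hK, hX⟩ := exists_hasDivergentOrbit b₀
  have := UniformSpace.secondCountable_of_separable (lp (fun _ : Fin 3 × ℕ => 𝕜) 2)
  obtain ⟨κ, bK, -⟩ := exists_hilbertBasis 𝕜 S.topologicalClosure
  have hκ : Countable κ := bK.orthonormal.countable_of_separableSpace
  have hκne : Nonempty κ := by
    by_contra h
    rw [not_nonempty_iff] at h
    obtain ⟨x, y, hxy⟩ := hK
    exact hxy (bK.repr.injective (lp.ext (funext fun j => h.elim j)))
  obtain ⟨ι, b, -⟩ := exists_hilbertBasis 𝕜 H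
  have hι : Infinite ι := by
    by_contra h
    rw [not_infinite_iff_finite] at h
    have := Fintype.ofFinite ι
    exact hH b.toOrthonormalBasis.toBasis.finiteDimensional_of_finite
  -- An infinite cardinal absorbs a nonzero countable factor, so a basis of `H` can be reindexed as
  -- `ι` copies of one of the cyclic subspace.
  obtain ⟨e⟩ : Nonempty (ι ≃ ι × κ) := by
    rw [← Cardinal.lift_mk_eq']
    simp only [Cardinal.mk_prod, Cardinal.lift_mul, Cardinal.lift_lift]
    refine (Cardinal.mul_eq_left ?_ ?_ ?_).symm
    · rw [Cardinal.aleph0_le_lift]; exact Cardinal.aleph0_le_mk ι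
    · refine le_trans (b := Cardinal.aleph0) ?_ ?_
      · rw [Cardinal.lift_le_aleph0]; exact Cardinal.mk_le_aleph0
      · rw [Cardinal.aleph0_le_lift]; exact Cardinal.aleph0_le_mk ι
    · rw [Ne, Cardinal.lift_eq_zero]; exact Cardinal.mk_ne_zero κ
  have hb' : Orthonormal 𝕜 (b ∘ e.symm) := b.orthonormal.comp _ e.symm.injective
  let b' : HilbertBasis (ι × κ) 𝕜 H := HilbertBasis.mk hb' (by
    rw [Set.range_comp, e.symm.surjective.range_eq, Set.image_univ, b.dense_span])
  exact exists_hasDivergentOrbit_of_hilbertBasis bK b' X hX
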